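/- Two discs move in the plane without obstacles; let $s>0$ be the sum of their radii. A placement is a pair $P=(A,B)$ of points of $\mathbb{R}^2$ (the centres); it is compatible if $\|A-B\|\ge s$, and its angle is the angle of the vector from $B$ to $A$ with respect to the $x$-axis. A motion from $P_0=(A_0,B_0)$ to $P_1=(A_1,B_1)$ is a pair $m=(\xi_A,\xi_B)$ of continuous rectifiable curves $[0,1]\to\mathbb{R}^2$, with $\xi_A$ going from $A_0$ to $A_1$ and $\xi_B$ from $B_0$ to $B_1$; it is compatible if $(\xi_A(t),\xi_B(t))$ is compatible for every $t\in[0,1]$. Its length $\ell(m)$ is the sum of the arc lengths of $\xi_A$ and $\xi_B$, and $m$ is optimal if it is compatible and no compatible motion from $P_0$ to $P_1$ is shorter. Let $P_0=(A_0,B_0)$ and $P_1=(A_1,B_1)$ be compatible placements. Let $\theta_0$ and $\theta_1$ be angles of $P_0$ and $P_1$, chosen so that $\theta_0\le\theta_1<\theta_0+2\pi$, and let $[\theta_0,\theta_1]\subseteq S^1=\mathbb{R}/2\pi\mathbb{Z}$ be the range of angles counter-clockwise from the angle of $P_0$ to the angle of $P_1$. Let $$H_A(\theta)=\sup_{(x,y)\in\overline{A_0A_1}}(x\cos\theta+y\sin\theta),\qquad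 H_B(\theta)=\sup_{(x,y)\in\overline{B_0B_1}}(x\cos\theta+y\sin\theta)$$ be the support functions of the segments $\overline{A_0A_1}$ and $\overline{B_0B_1}$, and let $H_{AB}(\theta)=H_A(\theta)+H_B(\pi+\theta)$. For $I\subseteq S^1$ let $$F_I(\theta)=\begin{cases}\max(H_{AB}(\theta),\,s) & \text{if }\theta\in I,\\ H_{AB}(\theta) & \text{if }\theta\notin I.\end{cases}$$ Then an optimal motion from $P_0$ to $P_1$ exists, and every optimal motion $m$ from $P_0$ to $P_1$ satisfies $$\ell(m)=\min\left(\int_0^{2\pi}F_{[\theta_0,\theta_1]}(\theta)\,d\theta,\ \int_0^{2\pi}F_{S^1\setminus[\theta_0,\theta_1]}(\theta)\,d\theta\right)-|\overline{A_0A_1}|-|\overline{B_0B_1}|.$$ -/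

import Mathlib

/-- The Euclidean plane. -/
abbrev Plane : Type := EuclideanSpace ℝ (Fin 2)

/-- A placement of a pair of discs: the positions of the two centres. -/
structure Placement where
  /-- centre of the first disc -/
  A : Plane
  /-- centre of the second disc -/
  B : Plane

/-- A placement is compatible, for discs whose radii sum to `s`, if the centres are at distance
at least `s`. -/
def Placement.IsCompatible (s : ℝ) (P : Placement) : Prop :=
  s ≤ dist P.A P.B

/-- `θ` is an angle of the placement `P`: the vector from `B` to `A` makes the angle `θ` with the
`x`-axis (angles are real numbers, determined modulo `2π`). -/
def Placement.HasAngle (P : Placement) (θ : ℝ) : Prop :=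
  P.A - P.B = dist P.A P.B • !₂[Real.cos θ, Real.sin θ]

/-- A trajectory from `p` to `q`: a continuous curve parametrized by `[0, 1]` that is
rectifiable. -/
structure Trajectory (p q : Plane) where
  /-- the underlying continuous curve -/
  curve : Path p q
  rectifiable : eVariationOn curve Set.univ ≠ ⊤

/-- The Euclidean arc length of a trajectory: the supremum over all subdivisions of the length of
the inscribed polygonal line (finite, by rectifiability). -/
noncomputable def Trajectory.length {p q : Plane} (ξ : Trajectory p q) : ℝ :=
  (eVariationOn ξ.curve Set.univ).toReal

/-- A coordinated motion from the placement `P₀` to the placement `P₁`. -/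
structure Motion (P₀ P₁ : Placement) where
  /-- trajectory of the first disc -/
  trajA : Trajectory P₀.A P₁.A
  /-- trajectory of the second disc -/
  trajB : Trajectory P₀.B P₁.B

namespace Motion

variable {P₀ P₁ : Placement}

/-- The placement of the pair at time `t`. -/
def placement (m : Motion P₀ P₁) (t : unitInterval) : Placement where
  A := m.trajA.curve t
  B := m.trajB.curve t

/-- A motion is compatible if all of its placements are. -/
def IsCompatible (s : ℝ) (m : Motion P₀ P₁) : Prop :=
  ∀ t : unitInterval, (m.placement t).IsCompatible s

/-- The length of a motion: the sum of the lengths of the two trajectories. -/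
noncomputable def length (m : Motion P₀ P₁) : ℝ :=
  m.trajA.length + m.trajB.length

/-- An optimal (shortest) motion: a compatible motion of minimum length among all compatible
motions with the same initial and final placements. -/
def IsOptimal (s : ℝ) (m : Motion P₀ P₁) : Prop :=
  m.IsCompatible s ∧ ∀ m' : Motion P₀ P₁, m'.IsCompatible s → m.length ≤ m'.length

end Motion

/-- The support function of a set `C` in the plane,
`h_C(θ) = sup {x cos θ + y sin θ : (x, y) ∈ C}`. -/
noncomputable def supportFunction (C : Set Plane) (θ : ℝ) : ℝ :=
  sSup ((fun p : Plane => p 0 * Real.cos θ + p 1 * Real.sin θ) '' C)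

/-- `H_AB(θ) = H_A(θ) + H_B(π + θ)`, where `H_A` and `H_B` are the support functions of the segments
`A₀A₁` and `B₀B₁`. -/
noncomputable def segmentSupport (P₀ P₁ : Placement) (θ : ℝ) : ℝ :=
  supportFunction (segment ℝ P₀.A P₁.A) θ + supportFunction (segment ℝ P₀.B P₁.B) (Real.pi + θ)

/-- The set of angles `[θ₀, θ₁]` on the circle `ℝ / 2πℤ`, as a `2π`-periodic set of reals. -/
def angleRange (θ₀ θ₁ : ℝ) : Set ℝ :=
  {θ | ∃ k : ℤ, θ + 2 * Real.pi * k ∈ Set.Icc θ₀ θ₁}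

open Classical in
/-- The function `H_AB`, with the additional lower bound `s` imposed at the angles in `I` only:
`max (H_AB(θ), s)` for `θ ∈ I`, and `H_AB(θ)` for `θ ∉ I`. -/
noncomputable def supportBound (s : ℝ) (P₀ P₁ : Placement) (I : Set ℝ) (θ : ℝ) : ℝ :=
  if θ ∈ I then max (segmentSupport P₀ P₁ θ) s else segmentSupport P₀ P₁ θ

/-! Put p = A₀ - B₀, a = A₁ - A₀, b = B₁ - B₀. Then H_AB(θ) is `pr θ p + max (pr θ a) 0 + max (-pr θ
b) 0`, its integral over a full turn is 2‖a‖ + 2‖b‖, and F_I exceeds H_AB exactly by `deficit` on I.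
So the least length has to be ‖a‖ + ‖b‖ plus the smaller of the integrals of `deficit` over the two
ranges of angles between θ₀ and θ₁.

Lower bound (`Motion.length_ge`): the angle of a compatible motion lifts to a continuous real
function, which takes every value of one of the two ranges (`Motion.IsCompatible.covers`). The
support function of the first curve at θ plus that of the second at θ + π is at least H_AB
everywhere, and at least s at every angle met. Cauchy's formula, applied to each curve closed up by
its chord, bounds the integral of this sum by ℓ(m) + ‖a‖ + ‖b‖. The argument is run on inscribed
polygons (`integral_maxPr_le`).

Upper bound: only the relative position matters for compatibility, and moving it along a curve costs
at most the length of that curve, however the displacement is shared in a fixed proportion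
(`Reach.of_lipschitz`). For a turn by at most π, `Reach.of_angles` builds the motion. At the angle φ
the first disc helps if `pr φ a` is positive and the second if `pr φ b` is negative; the way these
signs change decides which disc moves when. The paths are straight lines and tangent–arc–tangent
paths (`Reach.tangent`), and `integral_le_deficit` compares their lengths with the integral of
`deficit`. The delicate cases are `Reach.of_signs_same` and `Reach.of_signs_opposite_of_le`. For a
turn by more than π, either a turn by π already suffices or the other sense of rotation is at least
as cheap (`Reach.of_angles_or`). The motion so obtained attains the lower bound, hence is optimal.
-/

open Set

/-! ### Concatenation, reversal and Lipschitz bounds for trajectories -/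

namespace Trajectory

variable {x y z : Plane}

/-- The concatenation of two paths varies at most as much as both of them together. -/
theorem eVariationOn_trans_le (γ : Path x y) (γ' : Path y z) :
    eVariationOn (γ.trans γ') univ ≤ eVariationOn γ univ + eVariationOn γ' univ := by
  have h0 : (1 / 2 : ℝ) ∈ unitInterval := ⟨by norm_num, by norm_num⟩
  set h : unitInterval := ⟨1 / 2, h0⟩ with hh
  have hu : (univ : Set unitInterval) = Iic h ∪ Ici h := by
    rw [Iic_union_Ici]
  rw [hu, eVariationOn.union (x := h) _ ⟨self_mem_Iic, fun _ hx => hx⟩ ⟨self_mem_Ici, fun _ hx => hx⟩,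
    ← hu]
  refine add_le_add ?_ ?_
  -- On each half the concatenation is one of the paths after a monotone change of parameter,
  -- clamped to `[0, 1]` so that it is defined everywhere; this cannot increase the variation.
  · have : EqOn (γ.trans γ') (γ ∘ fun t : unitInterval => projIcc 0 1 zero_le_one (2 * (t : ℝ)))
        (Iic h) := by
      intro t ht
      have ht' : (t : ℝ) ≤ 1 / 2 := ht
      simp only [Path.trans_apply, ht', dif_pos, Function.comp]
      congr 1
      apply Subtype.ext
      rw [projIcc_of_mem zero_le_one (show 2 * (t : ℝ) ∈ Icc 0 1 from
        ⟨by have := t.2.1; linarith, by linarith⟩)]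
    rw [eVariationOn.congr this]
    exact eVariationOn.comp_le_of_monotoneOn _ _
      (fun a _ b _ hab => monotone_projIcc _ (by have : (a : ℝ) ≤ b := hab; linarith))
      (fun _ _ => mem_univ _)
  · have : EqOn (γ.trans γ')
        (γ' ∘ fun t : unitInterval => projIcc 0 1 zero_le_one (2 * (t : ℝ) - 1)) (Ici h) := by
      intro t ht
      have ht' : 1 / 2 ≤ (t : ℝ) := ht
      rw [Path.trans_apply]
      split_ifs with h2
      · have h3 : (t : ℝ) = 1 / 2 := le_antisymm h2 ht'
        simp [Function.comp, h3, projIcc_left]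
      · simp only [Function.comp]
        congr 1
        apply Subtype.ext
        rw [projIcc_of_mem zero_le_one (show 2 * (t : ℝ) - 1 ∈ Icc 0 1 from
          ⟨by linarith, by have := t.2.2; linarith⟩)]
    rw [eVariationOn.congr this]
    exact eVariationOn.comp_le_of_monotoneOn _ _
      (fun a _ b _ hab => monotone_projIcc _ (by have : (a : ℝ) ≤ b := hab; linarith))
      (fun _ _ => mem_univ _)

/-- Concatenation of trajectories. -/
noncomputable def trans (ξ : Trajectory x y) (η : Trajectory y z) : Trajectory x z where
  curve := ξ.curve.trans η.curve
  rectifiable := ne_top_of_le_ne_top (ENNReal.add_ne_top.2 ⟨ξ.rectifiable, η.rectifiable⟩)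
    (eVariationOn_trans_le _ _)

theorem length_trans_le (ξ : Trajectory x y) (η : Trajectory y z) :
    (ξ.trans η).length ≤ ξ.length + η.length := by
  unfold length
  rw [← ENNReal.toReal_add ξ.rectifiable η.rectifiable]
  exact ENNReal.toReal_mono (ENNReal.add_ne_top.2 ⟨ξ.rectifiable, η.rectifiable⟩)
    (eVariationOn_trans_le _ _)

theorem eVariationOn_symm_le (γ : Path x y) :
    eVariationOn γ.symm univ ≤ eVariationOn γ univ :=
  eVariationOn.comp_le_of_antitoneOn _ unitInterval.symm
    (fun _ _ _ _ hab => unitInterval.symm_le_symm.2 hab) (fun _ _ => mem_univ _)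

/-- The reversed trajectory. -/
noncomputable def symm (ξ : Trajectory x y) : Trajectory y x where
  curve := ξ.curve.symm
  rectifiable := ne_top_of_le_ne_top ξ.rectifiable (eVariationOn_symm_le _)

theorem length_symm_le (ξ : Trajectory x y) : ξ.symm.length ≤ ξ.length :=
  ENNReal.toReal_mono ξ.rectifiable (eVariationOn_symm_le _)

theorem eVariationOn_le_of_lipschitz {f : unitInterval → Plane} {K : NNReal}
    (hf : LipschitzWith K f) : eVariationOn f univ ≤ K := by
  refine ((LipschitzOnWith.comp_eVariationOn_le (f := f) (g := id) (s := univ) (t := univ)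
    hf.lipschitzOnWith (mapsTo_univ _ _))).trans ?_
  have h1 : eVariationOn (id : unitInterval → unitInterval) univ
      = eVariationOn ((↑) : unitInterval → ℝ) univ := rfl
  have h2 : eVariationOn ((↑) : unitInterval → ℝ) univ ≤ 1 := by
    have h3 := MonotoneOn.eVariationOn_eq (f := ((↑) : unitInterval → ℝ)) (s := univ)
      (fun a _ b _ hab => hab) (mem_univ 0) (mem_univ 1)
    have h4 : (univ : Set unitInterval) ∩ Icc 0 1 = univ := by
      exact eq_univ_of_forall fun t => ⟨mem_univ _, t.2.1, t.2.2⟩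
    rw [h4] at h3
    exact h3.le.trans (by simp)
  rw [h1]
  calc (K : ENNReal) * _ ≤ K * 1 := by gcongr
    _ = K := mul_one _

/-- The trajectory of a Lipschitz curve. -/
noncomputable def ofLipschitz (f : unitInterval → Plane) (K : NNReal) (hf : LipschitzWith K f)
    (h0 : f 0 = x) (h1 : f 1 = y) : Trajectory x y where
  curve := ⟨⟨f, hf.continuous⟩, h0, h1⟩
  rectifiable := ne_top_of_le_ne_top ENNReal.coe_ne_top (eVariationOn_le_of_lipschitz hf)

theorem length_ofLipschitz_le (f : unitInterval → Plane) (K : NNReal) (hf : LipschitzWith K f)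
    (h0 : f 0 = x) (h1 : f 1 = y) : (ofLipschitz f K hf h0 h1).length ≤ K :=
  ENNReal.toReal_le_coe_of_le_coe (eVariationOn_le_of_lipschitz hf)

end Trajectory

/-! ### Reachability with a length bound -/

/-- The placement `Q` can be reached from `P` by a compatible motion of length at most `l`. -/
def Reach (s : ℝ) (P Q : Placement) (l : ℝ) : Prop :=
  ∃ m : Motion P Q, m.IsCompatible s ∧ m.length ≤ l

namespace Reach

variable {s l l' : ℝ} {P Q R : Placement}

theorem mono (h : Reach s P Q l) (hl : l ≤ l') : Reach s P Q l' := by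
  obtain ⟨m, hm, h⟩ := h
  exact ⟨m, hm, h.trans hl⟩

theorem trans (h : Reach s P Q l) (h' : Reach s Q R l') : Reach s P R (l + l') := by
  obtain ⟨m, hm, h⟩ := h
  obtain ⟨n, hn, h'⟩ := h'
  refine ⟨⟨m.trajA.trans n.trajA, m.trajB.trans n.trajB⟩, fun t => ?_, ?_⟩
  · simp only [Placement.IsCompatible, Motion.placement, Trajectory.trans, Path.trans_apply]
    split_ifs
    · exact hm _
    · exact hn _
  · have h1 := m.trajA.length_trans_le n.trajA
    have h2 := m.trajB.length_trans_le n.trajB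
    simp only [Motion.length] at *
    linarith

theorem symm (h : Reach s P Q l) : Reach s Q P l := by
  obtain ⟨m, hm, h⟩ := h
  refine ⟨⟨m.trajA.symm, m.trajB.symm⟩, fun t => hm (unitInterval.symm t), ?_⟩
  have h1 := m.trajA.length_symm_le
  have h2 := m.trajB.length_symm_le
  simp only [Motion.length] at *
  linarith

theorem swap (h : Reach s ⟨P.B, P.A⟩ ⟨Q.B, Q.A⟩ l) : Reach s P Q l := by
  obtain ⟨m, hm, h⟩ := h
  refine ⟨⟨m.trajB, m.trajA⟩, fun t => ?_, ?_⟩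
  · have := hm t
    simp only [Placement.IsCompatible, Motion.placement] at *
    rwa [dist_comm]
  · simp only [Motion.length] at *
    linarith

/-- If the difference of the two positions follows a Lipschitz curve `r`, then a fraction `c` of
the displacement can be given to the first disc and the rest to the second. -/
theorem of_lipschitz {r : ℝ → Plane} {K c : ℝ} (hc0 : 0 ≤ c) (hc1 : c ≤ 1)
    (hr : ∀ t t', dist (r t) (r t') ≤ K * |t - t'|) (hs : ∀ t ∈ Icc (0 : ℝ) 1, s ≤ ‖r t‖)
    (h0 : P.A - P.B = r 0) (hA : Q.A - P.A = c • (r 1 - r 0))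
    (hB : Q.B - P.B = -((1 - c) • (r 1 - r 0))) : Reach s P Q K := by
  have hK : 0 ≤ K := by
    have := dist_nonneg.trans (hr 1 0)
    simpa using this
  -- The discs trace copies of `r` scaled by c and -(1 - c), with Lipschitz constants c K and (1 -
  -- c) K, which add up to K.
  have lip : ∀ (d : ℝ) (C : Plane), 0 ≤ |d| * K → LipschitzWith (Real.toNNReal (|d| * K))
      (fun t : unitInterval => C + d • (r t - r 0)) := by
    intro d C hd
    refine LipschitzWith.of_dist_le_mul fun t t' => ?_
    rw [Real.coe_toNNReal _ hd, dist_add_left, dist_smul₀, dist_sub_right, Real.norm_eq_abs,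
      mul_assoc]
    exact mul_le_mul_of_nonneg_left (hr t t') (abs_nonneg d)
  have n1 : 0 ≤ |c| * K := by positivity
  have n2 : 0 ≤ |-(1 - c)| * K := by positivity
  set ξ : Trajectory P.A Q.A := Trajectory.ofLipschitz _ _ (lip c P.A n1) (by simp)
    (by rw [Icc.coe_one, ← hA]; abel) with hξ
  set η : Trajectory P.B Q.B := Trajectory.ofLipschitz _ _ (lip (-(1 - c)) P.B n2) (by simp)
    (by rw [Icc.coe_one, neg_smul, ← hB]; abel) with hη
  have lξ : ξ.length ≤ _ := Trajectory.length_ofLipschitz_le _ _ (lip c P.A n1) _ _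
  have lη : η.length ≤ _ := Trajectory.length_ofLipschitz_le _ _ (lip (-(1 - c)) P.B n2) _ _
  refine ⟨⟨ξ, η⟩, ?_, ?_⟩
  · intro t
    simp only [Placement.IsCompatible, Motion.placement]
    have : dist (P.A + c • (r t - r 0)) (P.B + (-(1 - c)) • (r t - r 0)) = ‖r t‖ := by
      rw [dist_eq_norm]
      congr 1
      have : P.A = P.B + r 0 := by rw [← h0]; abel
      rw [this]
      module
    change s ≤ dist (P.A + c • (r t - r 0)) (P.B + (-(1 - c)) • (r t - r 0))
    rw [this]
    exact hs t t.2
  · rw [Real.coe_toNNReal _ n1, abs_of_nonneg hc0] at lξ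
    rw [Real.coe_toNNReal _ n2, abs_neg, abs_of_nonneg (by linarith : 0 ≤ 1 - c)] at lη
    simp only [Motion.length]
    linarith

end Reach

/-! ### Components in a rotating orthonormal frame -/

/-- The unit vector at angle `φ`. -/
noncomputable def uvec (φ : ℝ) : Plane := !₂[Real.cos φ, Real.sin φ]

/-- The unit vector at angle `φ + π / 2`. -/
noncomputable def evec (φ : ℝ) : Plane := !₂[-Real.sin φ, Real.cos φ]

/-- The component of a vector in the direction `φ`. -/
noncomputable def pr (φ : ℝ) : Plane →ₗ[ℝ] ℝ where
  toFun x := x 0 * Real.cos φ + x 1 * Real.sin φ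
  map_add' x y := by simp; ring
  map_smul' c x := by simp; ring

/-- The component of a vector in the direction `φ + π / 2`. -/
noncomputable def tg (φ : ℝ) : Plane →ₗ[ℝ] ℝ where
  toFun x := -x 0 * Real.sin φ + x 1 * Real.cos φ
  map_add' x y := by simp; ring
  map_smul' c x := by simp; ring

theorem pr_apply (φ : ℝ) (x : Plane) : pr φ x = x 0 * Real.cos φ + x 1 * Real.sin φ := rfl

theorem tg_apply (φ : ℝ) (x : Plane) : tg φ x = -x 0 * Real.sin φ + x 1 * Real.cos φ := rfl

theorem plane_ext {x y : Plane} (h0 : x 0 = y 0) (h1 : x 1 = y 1) : x = y := by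
  ext i; fin_cases i <;> assumption

@[simp] theorem uvec_zero (φ : ℝ) : uvec φ 0 = Real.cos φ := rfl
@[simp] theorem uvec_one (φ : ℝ) : uvec φ 1 = Real.sin φ := rfl
@[simp] theorem evec_zero (φ : ℝ) : evec φ 0 = -Real.sin φ := rfl
@[simp] theorem evec_one (φ : ℝ) : evec φ 1 = Real.cos φ := rfl

theorem norm_sq_plane (x : Plane) : ‖x‖ ^ 2 = x 0 ^ 2 + x 1 ^ 2 := by
  rw [EuclideanSpace.norm_sq_eq]; simp

theorem norm_sq_eq_pr_tg (φ : ℝ) (x : Plane) : ‖x‖ ^ 2 = pr φ x ^ 2 + tg φ x ^ 2 := by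
  rw [norm_sq_plane, pr_apply, tg_apply]
  linear_combination (-(x 0 ^ 2 + x 1 ^ 2)) * Real.sin_sq_add_cos_sq φ

theorem abs_pr_le (φ : ℝ) (x : Plane) : |pr φ x| ≤ ‖x‖ := by
  refine abs_le_of_sq_le_sq ?_ (norm_nonneg x)
  rw [norm_sq_eq_pr_tg φ x]; nlinarith [sq_nonneg (tg φ x)]

theorem pr_le_norm (φ : ℝ) (x : Plane) : pr φ x ≤ ‖x‖ := (le_abs_self _).trans (abs_pr_le φ x)

theorem decomp (φ : ℝ) (x : Plane) : x = pr φ x • uvec φ + tg φ x • evec φ := by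
  have h := Real.sin_sq_add_cos_sq φ
  apply plane_ext
  · simp [pr_apply, tg_apply]; linear_combination (-x 0) * h
  · simp [pr_apply, tg_apply]; linear_combination (-x 1) * h

theorem pr_eq (φ θ : ℝ) (x : Plane) :
    pr θ x = pr φ x * Real.cos (θ - φ) + tg φ x * Real.sin (θ - φ) := by
  have h := Real.sin_sq_add_cos_sq φ
  rw [Real.cos_sub, Real.sin_sub]; simp only [pr_apply, tg_apply]
  linear_combination (-(x 0 * Real.cos θ + x 1 * Real.sin θ)) * h

@[simp] theorem pr_uvec (φ θ : ℝ) : pr φ (uvec θ) = Real.cos (φ - θ) := by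
  rw [Real.cos_sub]; simp [pr_apply]; ring

@[simp] theorem pr_evec (φ θ : ℝ) : pr φ (evec θ) = Real.sin (φ - θ) := by
  rw [Real.sin_sub]; simp [pr_apply]; ring

@[simp] theorem tg_uvec (φ θ : ℝ) : tg φ (uvec θ) = -Real.sin (φ - θ) := by
  rw [Real.sin_sub]; simp [tg_apply]; ring

@[simp] theorem tg_evec (φ θ : ℝ) : tg φ (evec θ) = Real.cos (φ - θ) := by
  rw [Real.cos_sub]; simp [tg_apply]; ring

@[simp] theorem norm_uvec (φ : ℝ) : ‖uvec φ‖ = 1 := by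
  have h := norm_sq_eq_pr_tg φ (uvec φ)
  rw [pr_uvec, tg_uvec] at h
  simp at h
  rcases h with h | h
  · exact h
  · have := norm_nonneg (uvec φ); linarith

@[simp] theorem norm_evec (φ : ℝ) : ‖evec φ‖ = 1 := by
  have h := norm_sq_eq_pr_tg φ (evec φ)
  rw [pr_evec, tg_evec] at h
  simp at h
  rcases h with h | h
  · exact h
  · have := norm_nonneg (evec φ); linarith

theorem hasDerivAt_pr (x : Plane) (φ : ℝ) : HasDerivAt (fun φ => pr φ x) (tg φ x) φ := by
  simp only [pr_apply, tg_apply]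
  exact (((Real.hasDerivAt_cos φ).const_mul (x 0)).add
    ((Real.hasDerivAt_sin φ).const_mul (x 1))).congr_deriv (by ring)

theorem hasDerivAt_tg (x : Plane) (φ : ℝ) : HasDerivAt (fun φ => tg φ x) (-pr φ x) φ := by
  simp only [pr_apply, tg_apply]
  exact (((Real.hasDerivAt_sin φ).const_mul (-x 0)).add
    ((Real.hasDerivAt_cos φ).const_mul (x 1))).congr_deriv (by ring)

@[fun_prop] theorem continuous_pr (x : Plane) : Continuous fun φ => pr φ x := by
  simp only [pr_apply]; fun_prop

theorem integral_pr (x : Plane) (α β : ℝ) : ∫ φ in α..β, pr φ x = tg α x - tg β x := by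
  rw [intervalIntegral.integral_eq_sub_of_hasDerivAt (f := fun φ => -tg φ x)]
  · ring
  · intro φ _
    exact (hasDerivAt_tg x φ).fun_neg.congr_deriv (neg_neg _)
  · exact (continuous_pr x).intervalIntegrable _ _

theorem pr_add_pi (φ : ℝ) (x : Plane) : pr (φ + Real.pi) x = -pr φ x := by
  simp [pr_apply]; ring

theorem pr_sub_pi (φ : ℝ) (x : Plane) : pr (φ - Real.pi) x = -pr φ x := by
  simp [pr_apply]; ring

theorem pr_add_two_pi (φ : ℝ) (x : Plane) : pr (φ + 2 * Real.pi) x = pr φ x := by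
  simp [pr_apply]

/-- A vector with a zero component in the direction `α` is a multiple of `evec α`. -/
theorem eq_smul_evec {α : ℝ} {x : Plane} (h : pr α x = 0) : x = tg α x • evec α := by
  have := decomp α x
  rwa [h, zero_smul, zero_add] at this

theorem norm_eq_abs_tg {α : ℝ} {x : Plane} (h : pr α x = 0) : ‖x‖ = |tg α x| := by
  have := norm_sq_eq_pr_tg α x
  rw [h] at this
  rw [← abs_of_nonneg (norm_nonneg x)]
  exact (sq_eq_sq_iff_abs_eq_abs _ _).1 (by linarith)

/-! ### Signs of components and tangency to the circle over a range of angles -/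

/-- Being at distance at least `s` in a direction passes to the angles in between. -/
theorem pr_ge_between {s ψ₀ ψ₁ φ : ℝ} {x : Plane} (hs : 0 < s) (h0 : s ≤ pr ψ₀ x)
    (h1 : s ≤ pr ψ₁ x) (hφ0 : ψ₀ ≤ φ) (hφ1 : φ ≤ ψ₁) (hπ : ψ₁ ≤ ψ₀ + Real.pi) :
    s ≤ pr φ x := by
  rcases hφ0.eq_or_lt with rfl | hφ0
  · exact h0
  rcases hφ1.eq_or_lt with rfl | hφ1
  · exact h1
  have e0 := pr_eq φ ψ₀ x
  have e1 := pr_eq φ ψ₁ x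
  have s0 : 0 < Real.sin (φ - ψ₀) := Real.sin_pos_of_pos_of_lt_pi (by linarith) (by linarith)
  have s1 : 0 < Real.sin (ψ₁ - φ) := Real.sin_pos_of_pos_of_lt_pi (by linarith) (by linarith)
  rw [← neg_sub φ ψ₀, Real.sin_neg, Real.cos_neg] at e0
  set S0 := Real.sin (φ - ψ₀)
  set S1 := Real.sin (ψ₁ - φ)
  set C0 := Real.cos (φ - ψ₀)
  set C1 := Real.cos (ψ₁ - φ)
  have c0 : C0 ≤ 1 := Real.cos_le_one _
  have c1 : C1 ≤ 1 := Real.cos_le_one _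
  -- The direction φ is a nonnegative combination of ψ₀ and ψ₁ by the sine rule; the coefficients
  -- S1, S0 have sum at least sin(ψ₁ - ψ₀) = C0 S1 + C1 S0.
  have key : pr φ x * (C0 * S1 + C1 * S0) = pr ψ₀ x * S1 + pr ψ₁ x * S0 := by
    rw [e0, e1]; ring
  have h2 : s * (S0 + S1) ≤ pr φ x * (C0 * S1 + C1 * S0) := by
    rw [key]; nlinarith
  have hpos : 0 < C0 * S1 + C1 * S0 := by
    have : C0 * S1 + C1 * S0 = Real.sin (ψ₁ - ψ₀) := by
      rw [show ψ₁ - ψ₀ = (ψ₁ - φ) + (φ - ψ₀) by ring, Real.sin_add]; ring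
    rw [this]
    have hge : 0 ≤ Real.sin (ψ₁ - ψ₀) :=
      Real.sin_nonneg_of_nonneg_of_le_pi (by linarith) (by linarith)
    -- For an angle of exactly π the sine vanishes, which contradicts the positive lower bound in
    -- `h2`.
    rcases hge.eq_or_lt with h | h
    · exfalso
      rw [this, ← h, mul_zero] at h2
      nlinarith
    · exact h
  by_contra hlt
  push Not at hlt
  have : pr φ x * (C0 * S1 + C1 * S0) < s * (C0 * S1 + C1 * S0) := by nlinarith
  have : s * (C0 * S1 + C1 * S0) ≤ s * (S0 + S1) := by
    apply mul_le_mul_of_nonneg_left _ hs.le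
    nlinarith
  linarith

/-- The component of `x` in the directions after a zero, and before the next one. -/
theorem pr_eq_of_zero {α : ℝ} {x : Plane} (h : pr α x = 0) (φ : ℝ) :
    pr φ x = tg α x * Real.sin (φ - α) := by
  rw [pr_eq α φ, h]; ring

/-- A sign change from positive to negative. -/
theorem exists_switch_neg {ψ₀ ψ₁ : ℝ} {x : Plane} (hle : ψ₀ ≤ ψ₁) (hπ : ψ₁ ≤ ψ₀ + Real.pi)
    (h0 : 0 < pr ψ₀ x) (h1 : pr ψ₁ x < 0) :
    ∃ α ∈ Ioo ψ₀ ψ₁, pr α x = 0 ∧ tg α x = -‖x‖ ∧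
      (∀ φ ∈ Icc ψ₀ α, 0 ≤ pr φ x) ∧ ∀ φ ∈ Icc α ψ₁, pr φ x ≤ 0 := by
  obtain ⟨α, hα, hz⟩ := intermediate_value_Icc' hle (continuous_pr x).continuousOn
    (show (0 : ℝ) ∈ Icc (pr ψ₁ x) (pr ψ₀ x) from ⟨h1.le, h0.le⟩)
  simp only at hz
  have hα0 : ψ₀ < α := lt_of_le_of_ne hα.1 (by rintro rfl; linarith)
  have hα1 : α < ψ₁ := lt_of_le_of_ne hα.2 (by rintro rfl; linarith)
  have ht : tg α x ≤ 0 := by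
    rw [pr_eq_of_zero hz] at h0
    have : Real.sin (ψ₀ - α) ≤ 0 :=
      Real.sin_nonpos_of_nonpos_of_neg_pi_le (by linarith) (by linarith)
    nlinarith
  refine ⟨α, ⟨hα0, hα1⟩, hz, ?_, fun φ hφ => ?_, fun φ hφ => ?_⟩
  · rw [norm_eq_abs_tg hz, abs_of_nonpos ht, neg_neg]
  · rw [pr_eq_of_zero hz]
    exact mul_nonneg_of_nonpos_of_nonpos ht
      (Real.sin_nonpos_of_nonpos_of_neg_pi_le (by linarith [hφ.2]) (by linarith [hφ.1]))
  · rw [pr_eq_of_zero hz]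
    exact mul_nonpos_of_nonpos_of_nonneg ht
      (Real.sin_nonneg_of_nonneg_of_le_pi (by linarith [hφ.1]) (by linarith [hφ.2]))

/-- A sign change from negative to positive. -/
theorem exists_switch_pos {ψ₀ ψ₁ : ℝ} {x : Plane} (hle : ψ₀ ≤ ψ₁) (hπ : ψ₁ ≤ ψ₀ + Real.pi)
    (h0 : pr ψ₀ x < 0) (h1 : 0 < pr ψ₁ x) :
    ∃ α ∈ Ioo ψ₀ ψ₁, pr α x = 0 ∧ tg α x = ‖x‖ ∧
      (∀ φ ∈ Icc ψ₀ α, pr φ x ≤ 0) ∧ ∀ φ ∈ Icc α ψ₁, 0 ≤ pr φ x := by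
  obtain ⟨α, hα, hz, ht, hl, hr⟩ := exists_switch_neg (x := -x) hle hπ (by simpa) (by simpa)
  simp only [map_neg, norm_neg, neg_eq_zero, neg_inj, neg_nonneg, neg_nonpos] at *
  exact ⟨α, hα, hz, ht, hl, hr⟩

/-- Without strict sign changes between the ends, the sign is constant. -/
theorem pr_nonneg_between {ψ₀ ψ₁ : ℝ} {x : Plane} (hπ : ψ₁ < ψ₀ + Real.pi)
    (h0 : 0 ≤ pr ψ₀ x) (h1 : 0 ≤ pr ψ₁ x) : ∀ φ ∈ Icc ψ₀ ψ₁, 0 ≤ pr φ x := by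
  intro φ hφ
  by_contra hneg
  push Not at hneg
  have hlt0 : ψ₀ < φ := lt_of_le_of_ne hφ.1 (by rintro rfl; linarith)
  have hlt1 : φ < ψ₁ := lt_of_le_of_ne hφ.2 (by rintro rfl; linarith)
  have e0 := pr_eq φ ψ₀ x
  have e1 := pr_eq φ ψ₁ x
  have s0 : 0 < Real.sin (φ - ψ₀) := Real.sin_pos_of_pos_of_lt_pi (by linarith) (by linarith)
  have s1 : 0 < Real.sin (ψ₁ - φ) := Real.sin_pos_of_pos_of_lt_pi (by linarith) (by linarith)
  have s2 : 0 < Real.sin (ψ₁ - ψ₀) := Real.sin_pos_of_pos_of_lt_pi (by linarith) (by linarith)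
  rw [← neg_sub φ ψ₀, Real.sin_neg, Real.cos_neg] at e0
  rw [show ψ₁ - ψ₀ = (ψ₁ - φ) + (φ - ψ₀) by ring, Real.sin_add] at s2
  have key : pr φ x * (Real.sin (ψ₁ - φ) * Real.cos (φ - ψ₀) + Real.cos (ψ₁ - φ) * Real.sin (φ - ψ₀))
      = pr ψ₀ x * Real.sin (ψ₁ - φ) + pr ψ₁ x * Real.sin (φ - ψ₀) := by
    rw [e0, e1]; ring
  have := mul_neg_of_neg_of_pos hneg s2
  rw [key] at this
  have := mul_nonneg h0 s1.le
  have := mul_nonneg h1 s0.le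
  linarith

/-- The four possible sign patterns over an angle of at most `π`. -/
theorem sign_cases {ψ₀ ψ₁ : ℝ} (x : Plane) (hle : ψ₀ ≤ ψ₁) (hπ : ψ₁ ≤ ψ₀ + Real.pi) :
    (∀ φ ∈ Icc ψ₀ ψ₁, 0 ≤ pr φ x) ∨ (∀ φ ∈ Icc ψ₀ ψ₁, pr φ x ≤ 0) ∨
      (0 < pr ψ₀ x ∧ pr ψ₁ x < 0) ∨ (pr ψ₀ x < 0 ∧ 0 < pr ψ₁ x) := by
  rcases hπ.eq_or_lt with rfl | hlt
  · rcases lt_trichotomy (pr ψ₀ x) 0 with h | h | h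
    · right; right; right
      exact ⟨h, by rw [pr_add_pi]; linarith⟩
    · have hs : ∀ φ ∈ Icc ψ₀ (ψ₀ + Real.pi), 0 ≤ Real.sin (φ - ψ₀) := fun φ hφ =>
        Real.sin_nonneg_of_nonneg_of_le_pi (by linarith [hφ.1]) (by linarith [hφ.2])
      rcases le_total 0 (tg ψ₀ x) with ht | ht
      · left
        intro φ hφ
        rw [pr_eq_of_zero h]
        exact mul_nonneg ht (hs φ hφ)
      · right; left
        intro φ hφ
        rw [pr_eq_of_zero h]
        exact mul_nonpos_of_nonpos_of_nonneg ht (hs φ hφ)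
    · right; right; left
      exact ⟨h, by rw [pr_add_pi]; linarith⟩
  · by_cases h0 : 0 ≤ pr ψ₀ x
    · by_cases h1 : 0 ≤ pr ψ₁ x
      · exact Or.inl (pr_nonneg_between hlt h0 h1)
      · push Not at h1
        rcases h0.eq_or_lt with h0 | h0
        · right; left
          have := pr_nonneg_between (x := -x) hlt (by simp [← h0]) (by simpa using h1.le)
          simpa using this
        · exact Or.inr (Or.inr (Or.inl ⟨h0, h1⟩))
    · push Not at h0
      by_cases h1 : pr ψ₁ x ≤ 0
      · right; left
        have := pr_nonneg_between (x := -x) hlt (by simpa using h0.le) (by simpa using h1)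
        simpa using this
      · push Not at h1
        exact Or.inr (Or.inr (Or.inr ⟨h0, h1⟩))

/-- The last angle before `δ` at which `x` supports the circle of radius `s`. -/
theorem exists_last_tangent {s ψ δ : ℝ} {x : Plane} (hle : ψ ≤ δ) (h0 : s ≤ pr ψ x)
    (h1 : pr δ x < s) :
    ∃ φ ∈ Ico ψ δ, pr φ x = s ∧ tg φ x ≤ 0 ∧ ∀ z ∈ Icc φ δ, pr z x ≤ s := by
  set S := {z | z ∈ Icc ψ δ ∧ s ≤ pr z x} with hS
  have hc : IsCompact S :=
    isCompact_Icc.inter_right (isClosed_le continuous_const (continuous_pr x))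
  obtain ⟨φ, hφ, hmax⟩ := hc.exists_isGreatest ⟨ψ, ⟨le_rfl, hle⟩, h0⟩
  have hlt : φ < δ := lt_of_le_of_ne hφ.1.2 (by rintro rfl; linarith [hφ.2])
  have hafter : ∀ z, φ < z → z ≤ δ → pr z x < s := by
    intro z hz hzδ
    by_contra hge
    push Not at hge
    exact absurd (hmax ⟨⟨hφ.1.1.trans hz.le, hzδ⟩, hge⟩) (not_le.2 hz)
  have hev : ∀ᶠ z in nhdsWithin φ (Ioi φ), pr z x < s := by
    filter_upwards [Ioo_mem_nhdsGT hlt] with z hz using hafter z hz.1 hz.2.le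
  have heq : pr φ x = s := by
    refine le_antisymm ?_ hφ.2
    have ht : Filter.Tendsto (fun z => pr z x) (nhdsWithin φ (Ioi φ)) (nhds (pr φ x)) :=
      ((continuous_pr x).tendsto φ).mono_left nhdsWithin_le_nhds
    exact le_of_tendsto ht (hev.mono fun _ h => h.le)
  refine ⟨φ, ⟨hφ.1.1, hlt⟩, heq, ?_, ?_⟩
  -- `tg φ x` is the derivative of the component, and the component is below s just after φ.
  · have hd := (hasDerivAt_pr x φ).hasDerivWithinAt (s := Ioi φ)
    rw [hasDerivWithinAt_iff_tendsto_slope' (by simp)] at hd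
    refine le_of_tendsto hd ?_
    filter_upwards [hev, self_mem_nhdsWithin] with z hz hz'
    rw [slope_def_field, heq]
    exact div_nonpos_of_nonpos_of_nonneg (by linarith) (sub_nonneg.2 (le_of_lt hz'))
  · intro z hz
    rcases hz.1.eq_or_lt with rfl | h
    · exact heq.le
    · exact (hafter z h hz.2).le

/-- The first angle after `δ` at which `x` supports the circle of radius `s`. -/
theorem exists_first_tangent {s ψ δ : ℝ} {x : Plane} (hle : δ ≤ ψ) (h0 : s ≤ pr ψ x)
    (h1 : pr δ x < s) :
    ∃ φ ∈ Ioc δ ψ, pr φ x = s ∧ 0 ≤ tg φ x ∧ ∀ z ∈ Icc δ φ, pr z x ≤ s := by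
  -- Reflection in the x-axis reverses angles and reduces this to the last tangent.
  have hp : ∀ φ, pr (-φ) (!₂[x 0, -x 1] : Plane) = pr φ x := by intro φ; simp [pr_apply]
  have ht : ∀ φ, tg (-φ) (!₂[x 0, -x 1] : Plane) = -tg φ x := by intro φ; simp [tg_apply]; ring
  obtain ⟨φ, hφ, e, t, h⟩ := exists_last_tangent (s := s) (neg_le_neg hle)
    (by rw [hp]; exact h0) (by rw [hp]; exact h1)
  have hp' : pr φ (!₂[x 0, -x 1] : Plane) = pr (-φ) x := by rw [← hp, neg_neg]
  have ht' : tg φ (!₂[x 0, -x 1] : Plane) = -tg (-φ) x := by rw [← ht, neg_neg]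
  refine ⟨-φ, ⟨by linarith [hφ.2], by linarith [hφ.1]⟩, by rw [← hp', e], by linarith, ?_⟩
  intro z hz
  rw [← hp]
  exact h (-z) ⟨by linarith [hz.2], by linarith [hz.1]⟩

/-! ### Relative displacements along lines, arcs and tangents -/

namespace Placement

/-- The position of the first centre relative to the second. -/
def rel (P : Placement) : Plane := P.A - P.B

/-- The placement whose relative position is displaced by `d`, a fraction `c` of the displacement
being done by the first disc. -/
noncomputable def shift (P : Placement) (c : ℝ) (d : Plane) : Placement :=
  ⟨P.A + c • d, P.B - (1 - c) • d⟩

theorem eq_of_coords {P Q : Placement} (hA : P.A = Q.A) (hB : P.B = Q.B) : P = Q := by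
  cases P; cases Q; simp_all

theorem rel_shift (P : Placement) (c : ℝ) (d : Plane) : (P.shift c d).rel = P.rel + d := by
  simp only [rel, shift]; module

theorem shift_shift (P : Placement) (c : ℝ) (d d' : Plane) :
    (P.shift c d).shift c d' = P.shift c (d + d') := by
  apply eq_of_coords <;> simp only [shift] <;> module

end Placement

theorem dist_uvec_le (x y : ℝ) : dist (uvec x) (uvec y) ≤ |x - y| := by
  rw [dist_eq_norm]
  refine abs_le_of_sq_le_sq' ?_ (abs_nonneg _) |>.2
  rw [norm_sq_eq_pr_tg y, map_sub, map_sub, pr_uvec, pr_uvec, tg_uvec, tg_uvec, sq_abs]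
  have h := Real.one_sub_sq_div_two_le_cos (x := y - x)
  have h' := Real.sin_sq_add_cos_sq (y - x)
  simp only [sub_self, Real.cos_zero, Real.sin_zero]
  nlinarith

namespace Reach

variable {s c : ℝ} {P Q : Placement}

/-- A straight relative displacement within a half-plane that misses the open disc. -/
theorem line {φ : ℝ} {d : Plane} (hc0 : 0 ≤ c) (hc1 : c ≤ 1) (h0 : s ≤ pr φ P.rel)
    (h1 : s ≤ pr φ (P.rel + d)) : Reach s P (P.shift c d) ‖d‖ := by
  refine of_lipschitz (r := fun t => P.rel + t • d) hc0 hc1 (fun t t' => ?_) (fun t ht => ?_) ?_ ?_ ?_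
  · rw [dist_add_left, dist_eq_norm, ← sub_smul, norm_smul, Real.norm_eq_abs, mul_comm]
  · refine le_trans ?_ (pr_le_norm φ _)
    simp only [map_add, map_smul, smul_eq_mul] at *
    nlinarith [ht.1, ht.2]
  · simp [Placement.rel]
  · simp [Placement.shift]
  · simp [Placement.shift]

/-- A relative displacement along an arc of the circle of radius `s`. -/
theorem arc {φ₀ φ₁ : ℝ} (hs : 0 ≤ s) (hc0 : 0 ≤ c) (hc1 : c ≤ 1) (hle : φ₀ ≤ φ₁)
    (h0 : P.rel = s • uvec φ₀) :
    Reach s P (P.shift c (s • uvec φ₁ - s • uvec φ₀)) (s * (φ₁ - φ₀)) := by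
  refine of_lipschitz (r := fun t => s • uvec (φ₀ + t * (φ₁ - φ₀))) hc0 hc1 (fun t t' => ?_)
    (fun t ht => ?_) ?_ ?_ ?_
  · rw [dist_smul₀, Real.norm_eq_abs, abs_of_nonneg hs, mul_assoc]
    refine mul_le_mul_of_nonneg_left ((dist_uvec_le _ _).trans (le_of_eq ?_)) hs
    rw [← abs_of_nonneg (sub_nonneg.2 hle), ← abs_mul, abs_of_nonneg (sub_nonneg.2 hle)]
    congr 1; ring
  · rw [norm_smul, norm_uvec, Real.norm_eq_abs, abs_of_nonneg hs, mul_one]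
  · simpa [Placement.rel] using h0
  · simp [Placement.shift]
  · simp [Placement.shift]

/-- A relative displacement along a tangent to the circle of radius `s`, an arc of this circle, and
another tangent. -/
theorem tangent {φ₀ φ₁ : ℝ} {d : Plane} (hs : 0 ≤ s) (hc0 : 0 ≤ c) (hc1 : c ≤ 1) (hle : φ₀ ≤ φ₁)
    (h0 : pr φ₀ P.rel = s) (t0 : tg φ₀ P.rel ≤ 0) (h1 : pr φ₁ (P.rel + d) = s)
    (t1 : 0 ≤ tg φ₁ (P.rel + d)) :
    Reach s P (P.shift c d) (-tg φ₀ P.rel + s * (φ₁ - φ₀) + tg φ₁ (P.rel + d)) := by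
  have e0 := decomp φ₀ P.rel
  have e1 := decomp φ₁ (P.rel + d)
  rw [h0] at e0
  rw [h1] at e1
  have r1 : (P.shift c (-(tg φ₀ P.rel • evec φ₀))).rel = s • uvec φ₀ := by
    rw [Placement.rel_shift]; nth_rewrite 1 [e0]; abel
  have L1 := line (s := s) (P := P) (φ := φ₀) (d := -(tg φ₀ P.rel • evec φ₀)) hc0 hc1 h0.ge
    (by rw [← Placement.rel_shift P c, r1]; simp)
  have L2 := arc hs hc0 hc1 hle r1
  rw [Placement.shift_shift] at L2
  have r2 : (P.shift c (-(tg φ₀ P.rel • evec φ₀) + (s • uvec φ₁ - s • uvec φ₀))).rel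
      = s • uvec φ₁ := by
    rw [← Placement.shift_shift, Placement.rel_shift, r1]; abel
  have L3 := line (s := s) (φ := φ₁) (d := tg φ₁ (P.rel + d) • evec φ₁) hc0 hc1
    (by rw [r2]; simp) (by rw [r2, ← e1, h1])
  rw [Placement.shift_shift] at L3
  have hd : -(tg φ₀ P.rel • evec φ₀) + (s • uvec φ₁ - s • uvec φ₀)
      + tg φ₁ (P.rel + d) • evec φ₁ = d := by
    calc _ = (s • uvec φ₁ + tg φ₁ (P.rel + d) • evec φ₁)
        - (s • uvec φ₀ + tg φ₀ P.rel • evec φ₀) := by abel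
      _ = d := by rw [← e0, ← e1]; abel
  rw [hd] at L3
  refine ((L1.trans L2).trans L3).mono (le_of_eq ?_)
  rw [norm_neg, norm_smul, norm_smul, norm_evec, norm_evec, Real.norm_eq_abs, Real.norm_eq_abs,
    abs_of_nonpos t0, abs_of_nonneg t1]
  ring

end Reach

/-! ### The deficit and its integrals -/

/-- The amount by which `pr φ p + max (pr φ a) 0 + max (-pr φ b) 0` falls short of `s`. -/
noncomputable def deficit (s : ℝ) (p a b : Plane) (φ : ℝ) : ℝ :=
  max (s - (pr φ p + max (pr φ a) 0 + max (-pr φ b) 0)) 0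

section deficit

variable {s : ℝ} {p a b : Plane}

theorem deficit_nonneg (φ : ℝ) : 0 ≤ deficit s p a b φ := le_max_right _ _

@[fun_prop] theorem continuous_deficit : Continuous (deficit s p a b) := by
  unfold deficit; fun_prop

theorem intervalIntegrable_deficit (α β : ℝ) :
    IntervalIntegrable (deficit s p a b) MeasureTheory.volume α β :=
  continuous_deficit.intervalIntegrable _ _

theorem integral_deficit_nonneg {α β : ℝ} (h : α ≤ β) : 0 ≤ ∫ φ in α..β, deficit s p a b φ :=
  intervalIntegral.integral_nonneg h fun φ _ => deficit_nonneg φ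

theorem integral_deficit_mono {α β α' β' : ℝ} (h1 : α ≤ α') (h2 : α' ≤ β') (h3 : β' ≤ β) :
    ∫ φ in α'..β', deficit s p a b φ ≤ ∫ φ in α..β, deficit s p a b φ :=
  intervalIntegral.integral_mono_interval h1 h2 h3
    (Filter.Eventually.of_forall fun φ => deficit_nonneg φ) (intervalIntegrable_deficit _ _)

/-- Drop the truncation at 0 and integrate `pr` to -`tg`. Once the integrals of the maxima are
evaluated, the left side becomes the length of a tangent–arc–tangent path minus ‖a‖ + ‖b‖, which is
how the constructed motions are priced. -/
theorem integral_le_deficit {φ₀ φ₁ : ℝ} (h : φ₀ ≤ φ₁) :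
    s * (φ₁ - φ₀) - (tg φ₀ p - tg φ₁ p) - (∫ φ in φ₀..φ₁, max (pr φ a) 0)
      - (∫ φ in φ₀..φ₁, max (-pr φ b) 0) ≤ ∫ φ in φ₀..φ₁, deficit s p a b φ := by
  have i1 : Continuous fun φ => max (pr φ a) 0 := by fun_prop
  have i2 : Continuous fun φ => max (-pr φ b) 0 := by fun_prop
  calc _ = ∫ φ in φ₀..φ₁, (s - (pr φ p + max (pr φ a) 0 + max (-pr φ b) 0)) := by
        rw [intervalIntegral.integral_sub, intervalIntegral.integral_add,
          intervalIntegral.integral_add, integral_pr, intervalIntegral.integral_const]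
        · simp only [smul_eq_mul]; ring
        all_goals exact Continuous.intervalIntegrable (by fun_prop) _ _
    _ ≤ _ := intervalIntegral.integral_mono_on h
        (Continuous.intervalIntegrable (by fun_prop) _ _) (intervalIntegrable_deficit _ _)
        fun φ _ => le_max_left _ _

/-- Only the part before the switch α contributes, and there -`tg` is an antiderivative with value
‖a‖ at α. -/
theorem integral_max_neg {φ₀ φ₁ α : ℝ} (h0 : φ₀ ≤ α) (h1 : α ≤ φ₁) (ht : tg α a = -‖a‖)
    (hl : ∀ φ ∈ Icc φ₀ α, 0 ≤ pr φ a) (hr : ∀ φ ∈ Icc α φ₁, pr φ a ≤ 0) :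
    ∫ φ in φ₀..φ₁, max (pr φ a) 0 = tg φ₀ a + ‖a‖ := by
  have hc : Continuous fun φ => max (pr φ a) 0 := by fun_prop
  rw [← intervalIntegral.integral_add_adjacent_intervals (hc.intervalIntegrable φ₀ α)
    (hc.intervalIntegrable α φ₁)]
  rw [intervalIntegral.integral_congr (g := fun φ => pr φ a),
    intervalIntegral.integral_congr (g := fun _ => (0 : ℝ)) (a := α), integral_pr, ht]
  · simp
  · intro φ hφ
    rw [uIcc_of_le h1] at hφ
    exact max_eq_right (hr φ hφ)
  · intro φ hφ
    rw [uIcc_of_le h0] at hφ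
    exact max_eq_left (hl φ hφ)

theorem integral_max_pos {φ₀ φ₁ α : ℝ} (h0 : φ₀ ≤ α) (h1 : α ≤ φ₁) (ht : tg α a = ‖a‖)
    (hl : ∀ φ ∈ Icc φ₀ α, pr φ a ≤ 0) (hr : ∀ φ ∈ Icc α φ₁, 0 ≤ pr φ a) :
    ∫ φ in φ₀..φ₁, max (pr φ a) 0 = ‖a‖ - tg φ₁ a := by
  have hc : Continuous fun φ => max (pr φ a) 0 := by fun_prop
  rw [← intervalIntegral.integral_add_adjacent_intervals (hc.intervalIntegrable φ₀ α)
    (hc.intervalIntegrable α φ₁)]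
  rw [intervalIntegral.integral_congr (g := fun _ => (0 : ℝ)),
    intervalIntegral.integral_congr (g := fun φ => pr φ a) (a := α), integral_pr, ht]
  · simp
  · intro φ hφ
    rw [uIcc_of_le h1] at hφ
    exact max_eq_left (hr φ hφ)
  · intro φ hφ
    rw [uIcc_of_le h0] at hφ
    exact max_eq_right (hl φ hφ)

end deficit

/-! ### Motions that turn by at most π -/

/-- A displacement of the relative position shared in a fixed proportion, around the disc. -/
theorem Reach.single {s c ψ₀ ψ₁ : ℝ} {P : Placement} {d : Plane} (hs : 0 < s) (hc0 : 0 ≤ c)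
    (hc1 : c ≤ 1) (hle : ψ₀ ≤ ψ₁) (hπ : ψ₁ ≤ ψ₀ + Real.pi) (h0 : s ≤ pr ψ₀ P.rel)
    (h1 : s ≤ pr ψ₁ (P.rel + d)) :
    Reach s P (P.shift c d) (‖d‖ + ∫ φ in ψ₀..ψ₁, deficit s P.rel d 0 φ) := by
  have hI := integral_deficit_nonneg (s := s) (p := P.rel) (a := d) (b := 0) hle
  by_cases k0 : 0 ≤ pr ψ₀ d
  · exact (Reach.line hc0 hc1 h0 (by rw [map_add]; linarith)).mono (by linarith)
  by_cases k1 : pr ψ₁ d ≤ 0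
  · exact (Reach.line hc0 hc1 (by rw [map_add] at h1; linarith) h1).mono (by linarith)
  push Not at k0 k1
  -- Now d hinders at ψ₀ and helps at ψ₁. At the switch δ both ends have the same component: if it
  -- is at least s a straight line works, otherwise the path wraps around the circle between
  -- tangents on either side of δ.
  obtain ⟨δ, hδ, hz, ht, hl, hr⟩ := exists_switch_pos hle hπ k0 k1
  by_cases kδ : s ≤ pr δ P.rel
  · exact (Reach.line hc0 hc1 kδ (by rw [map_add, hz]; linarith)).mono (by linarith)
  push Not at kδ
  obtain ⟨φ₀, hφ₀, p0, t0, -⟩ := exists_last_tangent hδ.1.le h0 kδ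
  obtain ⟨φ₁, hφ₁, p1, t1, -⟩ := exists_first_tangent (x := P.rel + d) hδ.2.le h1
    (by rw [map_add, hz]; linarith)
  refine (Reach.tangent hs.le hc0 hc1 (by linarith [hφ₀.2, hφ₁.1]) p0 t0 p1 t1).mono ?_
  have e1 := integral_le_deficit (s := s) (p := P.rel) (a := d) (b := 0)
    (by linarith [hφ₀.2, hφ₁.1] : φ₀ ≤ φ₁)
  have e2 := integral_deficit_mono (s := s) (p := P.rel) (a := d) (b := 0) hφ₀.1
    (by linarith [hφ₀.2, hφ₁.1] : φ₀ ≤ φ₁) hφ₁.2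
  rw [integral_max_pos hφ₀.2.le hφ₁.1.le ht (fun φ hφ => hl φ ⟨hφ₀.1.trans hφ.1, hφ.2⟩)
    (fun φ hφ => hr φ ⟨hφ.1, hφ.2.trans hφ₁.2⟩)] at e1
  simp only [map_zero, neg_zero, max_self, intervalIntegral.integral_zero, map_add] at e1 ⊢
  linarith

section deficit

variable {s : ℝ} {p a b : Plane} {φ : ℝ}

/-- Where the sign of a component is known, the supporting endpoint of that segment is known too, so
the deficit is that of the other disc moving alone. -/
theorem deficit_of_pr_b_nonneg (h : 0 ≤ pr φ b) : deficit s p a b φ = deficit s p a 0 φ := by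
  simp [deficit, max_eq_right (neg_nonpos.2 h)]

theorem deficit_of_pr_a_nonpos (h : pr φ a ≤ 0) : deficit s p a b φ = deficit s p 0 b φ := by
  simp [deficit, max_eq_right h]

theorem deficit_of_pr_a_nonneg (h : 0 ≤ pr φ a) : deficit s p a b φ = deficit s (p + a) 0 b φ := by
  simp [deficit, max_eq_left h]

/-- Exchanging the discs reverses the relative position, hence the shift by π. -/
theorem deficit_add_pi : deficit s (-p) b a (φ + Real.pi) = deficit s p a b φ := by
  simp only [deficit, pr_add_pi, map_neg, neg_neg]
  congr 2; ring

end deficit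

namespace Reach

variable {s ψ₀ ψ₁ φ : ℝ} {A₀ A₁ B₀ B₁ : Plane}

theorem lineA (h0 : s ≤ pr φ (A₀ - B₀)) (h1 : s ≤ pr φ (A₁ - B₀)) :
    Reach s ⟨A₀, B₀⟩ ⟨A₁, B₀⟩ ‖A₁ - A₀‖ := by
  have h := line (s := s) (P := ⟨A₀, B₀⟩) (c := 1) (d := A₁ - A₀) (φ := φ) zero_le_one le_rfl h0
    (by simp only [Placement.rel, map_add, map_sub] at *; linarith)
  convert h using 1
  apply Placement.eq_of_coords <;> simp [Placement.shift]

theorem lineB (h0 : s ≤ pr φ (A₀ - B₀)) (h1 : s ≤ pr φ (A₀ - B₁)) :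
    Reach s ⟨A₀, B₀⟩ ⟨A₀, B₁⟩ ‖B₁ - B₀‖ := by
  have h := line (s := s) (P := ⟨A₀, B₀⟩) (c := 0) (d := B₀ - B₁) (φ := φ) le_rfl zero_le_one h0
    (by simp only [Placement.rel, map_add, map_sub] at *; linarith)
  rw [norm_sub_rev] at h
  convert h using 1
  apply Placement.eq_of_coords <;> simp [Placement.shift]

theorem singleA (hs : 0 < s) (hle : ψ₀ ≤ ψ₁) (hπ : ψ₁ ≤ ψ₀ + Real.pi)
    (h0 : s ≤ pr ψ₀ (A₀ - B₀)) (h1 : s ≤ pr ψ₁ (A₁ - B₀)) :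
    Reach s ⟨A₀, B₀⟩ ⟨A₁, B₀⟩
      (‖A₁ - A₀‖ + ∫ φ in ψ₀..ψ₁, deficit s (A₀ - B₀) (A₁ - A₀) 0 φ) := by
  have h := single (s := s) (P := ⟨A₀, B₀⟩) (c := 1) (d := A₁ - A₀) hs zero_le_one le_rfl hle hπ
    h0 (by simp only [Placement.rel, map_add, map_sub] at *; linarith)
  convert h using 1
  · apply Placement.eq_of_coords <;> simp [Placement.shift]
  · rfl

theorem singleB (hs : 0 < s) (hle : ψ₀ ≤ ψ₁) (hπ : ψ₁ ≤ ψ₀ + Real.pi)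
    (h0 : s ≤ pr ψ₀ (A₀ - B₀)) (h1 : s ≤ pr ψ₁ (A₀ - B₁)) :
    Reach s ⟨A₀, B₀⟩ ⟨A₀, B₁⟩
      (‖B₁ - B₀‖ + ∫ φ in ψ₀..ψ₁, deficit s (A₀ - B₀) 0 (B₁ - B₀) φ) := by
  have h := single (s := s) (P := ⟨A₀, B₀⟩) (c := 0) (d := B₀ - B₁) hs le_rfl zero_le_one hle hπ
    h0 (by simp only [Placement.rel, map_add, map_sub] at *; linarith)
  rw [norm_sub_rev] at h
  have e : ∀ φ, deficit s (A₀ - B₀) 0 (B₁ - B₀) φ = deficit s (A₀ - B₀) (B₀ - B₁) 0 φ := by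
    intro φ; simp [deficit]
  simp only [e]
  convert h using 1
  · apply Placement.eq_of_coords <;> simp [Placement.shift]
  · rfl

/-- The roles of the two discs can be exchanged. -/
theorem of_swap
    (h : Reach s ⟨B₀, A₀⟩ ⟨B₁, A₁⟩ (‖B₁ - B₀‖ + ‖A₁ - A₀‖ +
      ∫ φ in (ψ₀ + Real.pi)..(ψ₁ + Real.pi), deficit s (B₀ - A₀) (B₁ - B₀) (A₁ - A₀) φ)) :
    Reach s ⟨A₀, B₀⟩ ⟨A₁, B₁⟩ (‖A₁ - A₀‖ + ‖B₁ - B₀‖ +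
      ∫ φ in ψ₀..ψ₁, deficit s (A₀ - B₀) (A₁ - A₀) (B₁ - B₀) φ) := by
  refine (swap (P := ⟨A₀, B₀⟩) (Q := ⟨A₁, B₁⟩) h).mono (le_of_eq ?_)
  rw [← intervalIntegral.integral_comp_add_right, ← neg_sub A₀ B₀, add_comm ‖B₁ - B₀‖]
  simp only [deficit_add_pi]

/-- The first disc moves first, on a straight line; the direction of its motion is favourable at
all angles. -/
theorem of_a_nonneg (hs : 0 < s) (hle : ψ₀ ≤ ψ₁) (hπ : ψ₁ ≤ ψ₀ + Real.pi)
    (h0 : s ≤ pr ψ₀ (A₀ - B₀)) (h1 : s ≤ pr ψ₁ (A₁ - B₁))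
    (ha : ∀ φ ∈ Icc ψ₀ ψ₁, 0 ≤ pr φ (A₁ - A₀)) :
    Reach s ⟨A₀, B₀⟩ ⟨A₁, B₁⟩ (‖A₁ - A₀‖ + ‖B₁ - B₀‖ +
      ∫ φ in ψ₀..ψ₁, deficit s (A₀ - B₀) (A₁ - A₀) (B₁ - B₀) φ) := by
  have h2 := ha ψ₀ ⟨le_rfl, hle⟩
  have h3 : s ≤ pr ψ₀ (A₁ - B₀) := by simp only [map_sub] at *; linarith
  refine ((lineA h0 h3).trans (singleB hs hle hπ h3 h1)).mono (le_of_eq ?_)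
  rw [add_assoc]
  congr 2
  refine intervalIntegral.integral_congr fun φ hφ => ?_
  rw [uIcc_of_le hle] at hφ
  rw [deficit_of_pr_a_nonneg (ha φ hφ)]
  congr 1; abel

/-- The first disc moves last, on a straight line; the direction of its motion is unfavourable at
all angles. -/
theorem of_a_nonpos (hs : 0 < s) (hle : ψ₀ ≤ ψ₁) (hπ : ψ₁ ≤ ψ₀ + Real.pi)
    (h0 : s ≤ pr ψ₀ (A₀ - B₀)) (h1 : s ≤ pr ψ₁ (A₁ - B₁))
    (ha : ∀ φ ∈ Icc ψ₀ ψ₁, pr φ (A₁ - A₀) ≤ 0) :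
    Reach s ⟨A₀, B₀⟩ ⟨A₁, B₁⟩ (‖A₁ - A₀‖ + ‖B₁ - B₀‖ +
      ∫ φ in ψ₀..ψ₁, deficit s (A₀ - B₀) (A₁ - A₀) (B₁ - B₀) φ) := by
  have h2 := ha ψ₁ ⟨hle, le_rfl⟩
  have h3 : s ≤ pr ψ₁ (A₀ - B₁) := by simp only [map_sub] at *; linarith
  refine ((singleB hs hle hπ h0 h3).trans (lineA h3 h1)).mono (le_of_eq ?_)
  rw [add_comm, ← add_assoc]
  congr 1
  refine intervalIntegral.integral_congr fun φ hφ => ?_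
  rw [uIcc_of_le hle] at hφ
  rw [deficit_of_pr_a_nonpos (ha φ hφ)]

/-- Decomposition of a vector along two directions. -/
theorem _root_.sin_smul_eq (φ₀ φ₁ : ℝ) (x : Plane) :
    Real.sin (φ₁ - φ₀) • x = pr φ₁ x • evec φ₀ - pr φ₀ x • evec φ₁ := by
  apply plane_ext <;> simp [pr_apply, Real.sin_sub] <;> ring

/-- Both discs first help and then hinder the rotation: the first disc makes a detour on straight
lines, before and after the second disc goes around. -/
theorem of_signs_same (hs : 0 < s) (hle : ψ₀ ≤ ψ₁) (hπ : ψ₁ ≤ ψ₀ + Real.pi)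
    (h0 : s ≤ pr ψ₀ (A₀ - B₀)) (h1 : s ≤ pr ψ₁ (A₁ - B₁))
    (ha0 : 0 < pr ψ₀ (A₁ - A₀)) (ha1 : pr ψ₁ (A₁ - A₀) < 0)
    (hb0 : 0 < pr ψ₀ (B₁ - B₀)) (hb1 : pr ψ₁ (B₁ - B₀) < 0) :
    Reach s ⟨A₀, B₀⟩ ⟨A₁, B₁⟩ (‖A₁ - A₀‖ + ‖B₁ - B₀‖ +
      ∫ φ in ψ₀..ψ₁, deficit s (A₀ - B₀) (A₁ - A₀) (B₁ - B₀) φ) := by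
  obtain ⟨α, hα, az, at', al, ar⟩ := exists_switch_neg hle hπ ha0 ha1
  obtain ⟨β, hβ, bz, bt, bl, br⟩ := exists_switch_neg hle hπ hb0 hb1
  -- If the initial placement is still good at α, the turn may start there, where a only hinders;
  -- dually, it may stop at α if the final placement is good there.
  by_cases kp : s ≤ pr α (A₀ - B₀)
  · refine (of_a_nonpos hs hα.2.le (by linarith [hα.1]) kp h1 ar).mono ?_
    have := integral_deficit_mono (s := s) (p := A₀ - B₀) (a := A₁ - A₀) (b := B₁ - B₀)
      hα.1.le hα.2.le le_rfl
    linarith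
  by_cases kq : s ≤ pr α (A₁ - B₁)
  · refine (of_a_nonneg hs hα.1.le (by linarith [hα.2]) h0 kq al).mono ?_
    have := integral_deficit_mono (s := s) (p := A₀ - B₀) (a := A₁ - A₀) (b := B₁ - B₀)
      le_rfl hα.1.le hα.2.le
    linarith
  push Not at kp kq
  have hv0 : s < pr ψ₀ (A₁ - B₀) := by simp only [map_sub] at *; linarith
  have hw1 : s < pr ψ₁ (A₀ - B₁) := by simp only [map_sub] at *; linarith
  -- Before both switches the supporting pair is (A₁, B₀), after both it is (A₀, B₁). At min α β,
  -- respectively max α β, the former, respectively the latter, fails to reach s, which yields the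
  -- tangent angles φ₀ and φ₁.
  have hv : pr (min α β) (A₁ - B₀) < s := by
    rcases le_total α β with h | h
    · rw [min_eq_left h]; simp only [map_sub] at *; linarith
    · rw [min_eq_right h]
      by_contra hc
      push Not at hc
      have := pr_ge_between (φ := α) (x := A₁ - B₁) hs
        (by simp only [map_sub] at *; linarith : s ≤ pr β (A₁ - B₁)) h1 h hα.2.le
        (by linarith [hβ.1])
      linarith
  have hw : pr (max α β) (A₀ - B₁) < s := by
    rcases le_total α β with h | h
    · rw [max_eq_right h]
      by_contra hc
      push Not at hc
      have := pr_ge_between (φ := α) (x := A₀ - B₀) hs h0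
        (by simp only [map_sub] at *; linarith : s ≤ pr β (A₀ - B₀)) hα.1.le h
        (by linarith [hβ.2])
      linarith
    · rw [max_eq_left h]; simp only [map_sub] at *; linarith
  obtain ⟨φ₀, hφ₀, p0, t0, -⟩ := exists_last_tangent (le_min hα.1.le hβ.1.le) hv0.le hv
  obtain ⟨φ₁, hφ₁, p1, t1, -⟩ := exists_first_tangent (max_le hα.2.le hβ.2.le) hw1.le hw
  have hφ₀' : ψ₀ < φ₀ := lt_of_le_of_ne hφ₀.1 (by rintro rfl; linarith)
  have hφ₁' : φ₁ < ψ₁ := lt_of_le_of_ne hφ₁.2 (by rintro rfl; linarith)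
  have o1 : φ₀ < α := hφ₀.2.trans_le (min_le_left _ _)
  have o2 : φ₀ < β := hφ₀.2.trans_le (min_le_right _ _)
  have o3 : α < φ₁ := (le_max_left _ _).trans_lt hφ₁.1
  have o4 : β < φ₁ := (le_max_right _ _).trans_lt hφ₁.1
  have hS : 0 < Real.sin (φ₁ - φ₀) := Real.sin_pos_of_pos_of_lt_pi (by linarith) (by linarith)
  have hS0 : 0 < Real.sin (φ₁ - ψ₀) := Real.sin_pos_of_pos_of_lt_pi (by linarith) (by linarith)
  have hS1 : 0 < Real.sin (ψ₁ - φ₀) := Real.sin_pos_of_pos_of_lt_pi (by linarith) (by linarith)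
  have hS2 : 0 < Real.sin (φ₀ - ψ₀) := Real.sin_pos_of_pos_of_lt_pi (by linarith) (by linarith)
  have hS3 : 0 < Real.sin (ψ₁ - φ₁) := Real.sin_pos_of_pos_of_lt_pi (by linarith) (by linarith)
  -- X and Y are the sides of the triangle over A₀A₁ whose edges are parallel to the tangents at φ₁
  -- and φ₀. The first disc visits its apex and waits there while the second goes around.
  set X := pr φ₀ (A₁ - A₀) / Real.sin (φ₁ - φ₀) with hX
  set Y := -pr φ₁ (A₁ - A₀) / Real.sin (φ₁ - φ₀) with hY
  have hX0 : 0 ≤ X := div_nonneg (al φ₀ ⟨hφ₀.1, o1.le⟩) hS.le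
  have hY0 : 0 ≤ Y := div_nonneg (neg_nonneg.2 (ar φ₁ ⟨o3.le, hφ₁.2⟩)) hS.le
  have ea : A₁ - A₀ = -(X • evec φ₁) - Y • evec φ₀ := by
    have h := sin_smul_eq φ₀ φ₁ (A₁ - A₀)
    have h' : A₁ - A₀ = (Real.sin (φ₁ - φ₀))⁻¹ • (Real.sin (φ₁ - φ₀) • (A₁ - A₀)) := by
      rw [smul_smul, inv_mul_cancel₀ hS.ne', one_smul]
    rw [h', h, hX, hY, div_eq_inv_mul, div_eq_inv_mul]
    module
  have eA : A₁ = A₀ - X • evec φ₁ - Y • evec φ₀ := by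
    rw [← sub_eq_zero, ← sub_eq_zero.2 ea]; abel
  set d : Plane := (A₀ - B₁ - X • evec φ₁) - (A₁ - B₀ + Y • evec φ₀) with hd
  set R₁ : Placement := Placement.shift ⟨A₀, B₀⟩ 1 (-(X • evec φ₁)) with hR₁
  have r1 : R₁.rel = A₁ - B₀ + Y • evec φ₀ := by
    rw [hR₁, Placement.rel_shift, Placement.rel, eA]; abel
  have r2 : (R₁.shift 0 d).rel = A₀ - B₁ - X • evec φ₁ := by
    rw [Placement.rel_shift, r1, hd]; abel
  have q0 : s ≤ pr ψ₀ R₁.rel := by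
    rw [hR₁, Placement.rel_shift, Placement.rel, map_add, map_neg, map_smul, pr_evec, smul_eq_mul,
      ← neg_sub φ₁, Real.sin_neg]
    linarith [mul_nonneg hX0 hS0.le]
  have q1 : s ≤ pr ψ₁ (R₁.shift 0 d).rel := by
    have e : A₀ - B₁ - X • evec φ₁ = A₁ - B₁ + Y • evec φ₀ := by rw [eA]; abel
    rw [r2, e, map_add, map_smul, pr_evec, smul_eq_mul]
    linarith [mul_nonneg hY0 hS1.le]
  have q2 : pr φ₀ R₁.rel = s := by rw [r1, map_add, map_smul, pr_evec, p0]; simp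
  have q3 : pr φ₁ (R₁.rel + d) = s := by
    rw [← Placement.rel_shift R₁ 0, r2, map_sub, map_smul, pr_evec, p1]; simp
  have u2 : tg φ₀ R₁.rel ≤ 0 := by
    have e := pr_eq φ₀ ψ₀ R₁.rel
    rw [q2, ← neg_sub φ₀, Real.sin_neg, Real.cos_neg] at e
    have hcos := mul_le_mul_of_nonneg_left (Real.cos_le_one (φ₀ - ψ₀)) hs.le
    by_contra hc
    push Not at hc
    linarith [mul_pos hc hS2]
  have u3 : 0 ≤ tg φ₁ (R₁.rel + d) := by
    rw [← Placement.rel_shift R₁ 0] at q3 ⊢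
    have e := pr_eq φ₁ ψ₁ (R₁.shift 0 d).rel
    rw [q3] at e
    have hcos := mul_le_mul_of_nonneg_left (Real.cos_le_one (ψ₁ - φ₁)) hs.le
    by_contra hc
    push Not at hc
    linarith [mul_neg_of_neg_of_pos hc hS3]
  have M1 := line (s := s) (P := ⟨A₀, B₀⟩) (φ := ψ₀) (d := -(X • evec φ₁)) zero_le_one le_rfl h0
    (by rw [← Placement.rel_shift _ 1]; exact q0)
  have M2 := tangent hs.le le_rfl zero_le_one (o1.trans o3).le q2 u2 q3 u3
  have hend : (R₁.shift 0 d).shift 1 (-(Y • evec φ₀)) = ⟨A₁, B₁⟩ := by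
    apply Placement.eq_of_coords
    · simp only [Placement.shift, hR₁, eA]; module
    · simp only [Placement.shift, hR₁, hd, eA]; module
  have M3 := line (s := s) (P := R₁.shift 0 d) (φ := ψ₁) (d := -(Y • evec φ₀)) zero_le_one le_rfl
    q1 (by rw [← Placement.rel_shift _ 1, hend]; exact h1)
  rw [hend] at M3
  -- The detour X + Y is regained on the two tangent pieces, so the total is the length of the
  -- tangent path from A₁ - B₀ to A₀ - B₁.
  refine ((M1.trans M2).trans M3).mono ?_
  have e1 := integral_le_deficit (s := s) (p := A₀ - B₀) (a := A₁ - A₀) (b := B₁ - B₀)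
    (o1.trans o3).le
  have e2 := integral_deficit_mono (s := s) (p := A₀ - B₀) (a := A₁ - A₀) (b := B₁ - B₀) hφ₀.1
    (o1.trans o3).le hφ₁.2
  have e3 := integral_max_pos (a := -(B₁ - B₀)) o2.le o4.le (by rw [map_neg, bt, neg_neg, norm_neg])
    (fun φ hφ => by rw [map_neg, neg_nonpos]; exact bl φ ⟨hφ₀.1.trans hφ.1, hφ.2⟩)
    (fun φ hφ => by rw [map_neg, neg_nonneg]; exact br φ ⟨hφ.1, hφ.2.trans hφ₁.2⟩)
  simp only [map_neg, norm_neg] at e3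
  rw [e3, integral_max_neg o1.le o3.le at' (fun φ hφ => al φ ⟨hφ₀.1.trans hφ.1, hφ.2⟩)
    (fun φ hφ => ar φ ⟨hφ.1, hφ.2.trans hφ₁.2⟩)] at e1
  rw [← Placement.rel_shift R₁ 0, r2, r1, norm_neg, norm_neg, norm_smul, norm_smul, norm_evec,
    norm_evec, Real.norm_eq_abs, Real.norm_eq_abs, abs_of_nonneg hX0, abs_of_nonneg hY0]
  simp only [map_sub, map_add, map_smul, smul_eq_mul, tg_evec, sub_self, Real.cos_zero] at e1 ⊢
  linarith

end Reach

namespace Reach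

variable {s ψ₀ ψ₁ φ : ℝ} {A₀ A₁ B₀ B₁ : Plane}

/-- A point of the path around the disc whose component in the direction `α` is prescribed, and the
rest of the path from this point on. -/
theorem exists_intermediate {α φ₁ k : ℝ} {q : Plane} (hs : 0 < s) (hα : α < φ₁)
    (hπ : φ₁ < α + Real.pi) (q1 : pr φ₁ q = s) (t1 : 0 ≤ tg φ₁ q) (hk : k < s)
    (hqk : pr α q ≤ k) :
    ∃ φ ∈ Ioc α φ₁, ∃ y : Plane, pr φ y = s ∧ 0 ≤ tg φ y ∧ pr α y = k ∧
      ∀ R : Placement, R.rel = y →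
        Reach s R (R.shift 0 (q - y)) (s * (φ₁ - φ) + tg φ₁ q - tg φ y) := by
  -- The component in the direction α decreases along the arc from s; k is reached on the arc in
  -- this case, and otherwise on the tangent segment at φ₁.
  by_cases hc : s * Real.cos (φ₁ - α) ≤ k
  · obtain ⟨φ, hφ, e⟩ := intermediate_value_Icc' (f := fun φ => s * Real.cos (φ - α)) hα.le
      (by fun_prop) (show k ∈ Icc _ _ from ⟨hc, by simpa using hk.le⟩)
    simp only at e
    have hne : α < φ := lt_of_le_of_ne hφ.1 (by rintro rfl; simp at e; linarith)
    refine ⟨φ, ⟨hne, hφ.2⟩, s • uvec φ, by simp, by simp, ?_, fun R hR => ?_⟩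
    · rw [map_smul, pr_uvec, smul_eq_mul, ← Real.cos_neg, neg_sub, e]
    · have e' : R.rel + (q - s • uvec φ) = q := by rw [hR]; abel
      refine (tangent (φ₀ := φ) (φ₁ := φ₁) hs.le le_rfl zero_le_one hφ.2 (by rw [hR]; simp)
        (by rw [hR]; simp) (by rw [e', q1]) (by rw [e']; exact t1)).mono (le_of_eq ?_)
      rw [e', hR]; simp
  · push Not at hc
    have hS : 0 < Real.sin (φ₁ - α) := Real.sin_pos_of_pos_of_lt_pi (by linarith) (by linarith)
    have eα := pr_eq φ₁ α q
    rw [q1, ← neg_sub φ₁, Real.cos_neg, Real.sin_neg] at eα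
    set t := (s * Real.cos (φ₁ - α) - k) / Real.sin (φ₁ - α) with ht
    have htS : t * Real.sin (φ₁ - α) = s * Real.cos (φ₁ - α) - k := div_mul_cancel₀ _ hS.ne'
    have ht0 : 0 ≤ t := div_nonneg (by linarith) hS.le
    have ht1 : t ≤ tg φ₁ q := by
      rw [ht, div_le_iff₀ hS]; linarith
    have dq := decomp φ₁ q
    rw [q1] at dq
    refine ⟨φ₁, ⟨hα, le_rfl⟩, s • uvec φ₁ + t • evec φ₁, by simp, by simpa using ht0, ?_,
      fun R hR => ?_⟩
    · rw [map_add, map_smul, map_smul, pr_uvec, pr_evec, ← neg_sub φ₁, Real.cos_neg, Real.sin_neg,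
        smul_eq_mul, smul_eq_mul]
      linarith
    · have e' : R.rel + (q - (s • uvec φ₁ + t • evec φ₁)) = q := by rw [hR]; abel
      refine (line (φ := φ₁) le_rfl zero_le_one (by rw [hR]; simp) (by rw [e', q1])).mono
        (le_of_eq ?_)
      have : q - (s • uvec φ₁ + t • evec φ₁) = (tg φ₁ q - t) • evec φ₁ := by
        nth_rewrite 1 [dq]; module
      rw [this, norm_smul, norm_evec, Real.norm_eq_abs, abs_of_nonneg (by linarith)]
      simp

/-- Both discs first hinder and then help the rotation, the first one changing before the second
one. -/
theorem of_signs_opposite_of_le (hs : 0 < s) (hπ : ψ₁ ≤ ψ₀ + Real.pi)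
    (h0 : s ≤ pr ψ₀ (A₀ - B₀)) (h1 : s ≤ pr ψ₁ (A₁ - B₁)) {α β : ℝ}
    (hα : α ∈ Ioo ψ₀ ψ₁) (az : pr α (A₁ - A₀) = 0) (at' : tg α (A₁ - A₀) = ‖A₁ - A₀‖)
    (al : ∀ φ ∈ Icc ψ₀ α, pr φ (A₁ - A₀) ≤ 0) (ar : ∀ φ ∈ Icc α ψ₁, 0 ≤ pr φ (A₁ - A₀))
    (hβ : β ∈ Ioo ψ₀ ψ₁) (bz : pr β (B₁ - B₀) = 0) (bt : tg β (B₁ - B₀) = -‖B₁ - B₀‖)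
    (bl : ∀ φ ∈ Icc ψ₀ β, 0 ≤ pr φ (B₁ - B₀)) (br : ∀ φ ∈ Icc β ψ₁, pr φ (B₁ - B₀) ≤ 0)
    (hαβ : α ≤ β) :
    Reach s ⟨A₀, B₀⟩ ⟨A₁, B₁⟩ (‖A₁ - A₀‖ + ‖B₁ - B₀‖ +
      ∫ φ in ψ₀..ψ₁, deficit s (A₀ - B₀) (A₁ - A₀) (B₁ - B₀) φ) := by
  -- Between α and β the supporting pair is (A₁, B₀). If it reaches s at some m, the first disc
  -- makes its whole move up to the angle m and the second one afterwards.
  by_cases hm : ∃ m ∈ Icc α β, s ≤ pr m (A₁ - B₀)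
  · obtain ⟨m, hm, hv⟩ := hm
    have o0 : ψ₀ ≤ m := hα.1.le.trans hm.1
    have o1 : m ≤ ψ₁ := hm.2.trans hβ.2.le
    refine ((singleA hs o0 (by linarith) h0 hv).trans
      (singleB hs o1 (by linarith) hv h1)).mono (le_of_eq ?_)
    have e1 : ∫ φ in ψ₀..m, deficit s (A₀ - B₀) (A₁ - A₀) 0 φ =
        ∫ φ in ψ₀..m, deficit s (A₀ - B₀) (A₁ - A₀) (B₁ - B₀) φ := by
      refine intervalIntegral.integral_congr fun φ hφ => ?_
      rw [uIcc_of_le o0] at hφ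
      exact (deficit_of_pr_b_nonneg (bl φ ⟨hφ.1, hφ.2.trans hm.2⟩)).symm
    have e2 : ∫ φ in m..ψ₁, deficit s (A₁ - B₀) 0 (B₁ - B₀) φ =
        ∫ φ in m..ψ₁, deficit s (A₀ - B₀) (A₁ - A₀) (B₁ - B₀) φ := by
      refine intervalIntegral.integral_congr fun φ hφ => ?_
      rw [uIcc_of_le o1] at hφ
      rw [deficit_of_pr_a_nonneg (ar φ ⟨hm.1.trans hφ.1, hφ.2⟩)]
      congr 1; abel
    rw [e1, e2, ← intervalIntegral.integral_add_adjacent_intervals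
      (intervalIntegrable_deficit ψ₀ m) (intervalIntegrable_deficit m ψ₁)]
    ring
  push Not at hm
  have vα := hm α ⟨le_rfl, hαβ⟩
  have vβ := hm β ⟨hαβ, le_rfl⟩
  obtain ⟨φ₀, hφ₀, p0, t0, -⟩ := exists_last_tangent (x := A₀ - B₀) hα.1.le h0
    (by simp only [map_sub] at *; linarith)
  obtain ⟨φ₁, hφ₁, p1, t1, hq⟩ := exists_first_tangent (x := A₁ - B₁) hβ.2.le h1
    (by simp only [map_sub] at *; linarith)
  have o1 : φ₀ ≤ φ₁ := (hφ₀.2.le.trans hαβ).trans hφ₁.1.le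
  have vle : ∀ φ ∈ Icc α φ₁, pr φ (A₁ - B₀) ≤ s := by
    intro φ hφ
    rcases le_total φ β with h | h
    · exact (hm φ ⟨hφ.1, h⟩).le
    · have h2 := hq φ ⟨h, hφ.2⟩
      have h3 := br φ ⟨h, hφ.2.trans hφ₁.2⟩
      simp only [map_sub] at *; linarith
  have hbα := bl α ⟨hα.1.le, hαβ⟩
  -- Otherwise the relative position follows the tangent path from A₀ - B₀ to A₁ - B₁. Stopping at
  -- y, with the same α-component as A₀ - B₀, makes the displacement so far parallel to a; the first
  -- disc takes the fraction c of it that equals a and then rests.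
  obtain ⟨φ, hφ, y, py, ty, pyα, tail⟩ := exists_intermediate (q := A₁ - B₁)
    (k := pr α (A₀ - B₀)) hs (hαβ.trans_lt hφ₁.1) (by linarith [hφ₁.2, hα.1]) p1 t1
    (by simp only [map_sub] at *; linarith) (by simp only [map_sub] at *; linarith)
  have ha : 0 ≤ ‖A₁ - A₀‖ := norm_nonneg _
  have ea := eq_smul_evec az
  rw [at'] at ea
  have ey := eq_smul_evec (α := α) (x := y - (A₀ - B₀)) (by rw [map_sub, pyα, sub_self])
  set μ := tg α (y - (A₀ - B₀)) with hμ
  have hS : 0 < Real.sin (φ - α) :=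
    Real.sin_pos_of_pos_of_lt_pi (by linarith [hφ.1]) (by linarith [hφ.2, hφ₁.2, hα.1])
  -- This ensures c ≤ 1: in the direction φ the point y has component s and A₁ - B₀ at most s, and
  -- they differ by (μ - ‖a‖) `evec α`.
  have hμa : ‖A₁ - A₀‖ ≤ μ := by
    have e : y - (A₁ - B₀) = (μ - ‖A₁ - A₀‖) • evec α := by
      rw [sub_smul, ← ey, ← ea]; abel
    have e2 : pr φ (y - (A₁ - B₀)) = (μ - ‖A₁ - A₀‖) * Real.sin (φ - α) := by
      rw [e, map_smul, pr_evec, smul_eq_mul]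
    rw [map_sub, py] at e2
    have := vle φ ⟨hφ.1.le, hφ.2⟩
    by_contra hc
    push Not at hc
    have := mul_neg_of_neg_of_pos (sub_neg.2 hc) hS
    linarith
  obtain ⟨c, hc0, hc1, hc⟩ : ∃ c : ℝ, 0 ≤ c ∧ c ≤ 1 ∧ c * μ = ‖A₁ - A₀‖ := by
    rcases (ha.trans hμa).eq_or_lt with h | h
    · exact ⟨0, le_rfl, zero_le_one, by rw [zero_mul]; linarith⟩
    · exact ⟨‖A₁ - A₀‖ / μ, div_nonneg ha h.le, (div_le_one h).2 hμa, div_mul_cancel₀ _ h.ne'⟩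
  set R : Placement := Placement.shift ⟨A₀, B₀⟩ c (y - (A₀ - B₀)) with hR
  have rR : R.rel = y := by rw [hR, Placement.rel_shift, Placement.rel]; abel
  have cy : c • (y - (A₀ - B₀)) = A₁ - A₀ := by rw [ey, smul_smul, hc, ← ea]
  have hend : R.shift 0 (A₁ - B₁ - y) = ⟨A₁, B₁⟩ := by
    apply Placement.eq_of_coords
    · simp only [Placement.shift, hR, cy]; module
    · simp only [Placement.shift, hR, sub_smul, cy]; module
  have er : (Placement.rel ⟨A₀, B₀⟩) + (y - (A₀ - B₀)) = y := by
    simp only [Placement.rel]; abel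
  have M1 := tangent (s := s) (P := ⟨A₀, B₀⟩) (d := y - (A₀ - B₀)) hs.le hc0 hc1
    (hφ₀.2.le.trans hφ.1.le) p0 t0 (by rw [er, py]) (by rw [er]; exact ty)
  have M2 := tail R rR
  rw [hend] at M2
  refine (M1.trans M2).mono ?_
  rw [er]
  have e1 := integral_le_deficit (s := s) (p := A₀ - B₀) (a := A₁ - A₀) (b := B₁ - B₀) o1
  have e2 := integral_deficit_mono (s := s) (p := A₀ - B₀) (a := A₁ - A₀) (b := B₁ - B₀) hφ₀.1
    o1 hφ₁.2
  have e3 := integral_max_pos (a := -(B₁ - B₀)) (hφ₀.2.le.trans hαβ) hφ₁.1.le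
    (by rw [map_neg, bt, neg_neg, norm_neg])
    (fun φ hφ => by rw [map_neg, neg_nonpos]; exact bl φ ⟨hφ₀.1.trans hφ.1, hφ.2⟩)
    (fun φ hφ => by rw [map_neg, neg_nonneg]; exact br φ ⟨hφ.1, hφ.2.trans hφ₁.2⟩)
  simp only [map_neg, norm_neg] at e3
  rw [e3, integral_max_pos hφ₀.2.le (hαβ.trans hφ₁.1.le) at'
    (fun φ hφ => al φ ⟨hφ₀.1.trans hφ.1, hφ.2⟩)
    (fun φ hφ => ar φ ⟨hφ.1, hφ.2.trans hφ₁.2⟩)] at e1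
  simp only [map_sub, Placement.rel] at e1 ⊢
  linarith

theorem of_signs_opposite (hs : 0 < s) (hle : ψ₀ ≤ ψ₁) (hπ : ψ₁ ≤ ψ₀ + Real.pi)
    (h0 : s ≤ pr ψ₀ (A₀ - B₀)) (h1 : s ≤ pr ψ₁ (A₁ - B₁))
    (ha0 : pr ψ₀ (A₁ - A₀) < 0) (ha1 : 0 < pr ψ₁ (A₁ - A₀))
    (hb0 : 0 < pr ψ₀ (B₁ - B₀)) (hb1 : pr ψ₁ (B₁ - B₀) < 0) :
    Reach s ⟨A₀, B₀⟩ ⟨A₁, B₁⟩ (‖A₁ - A₀‖ + ‖B₁ - B₀‖ +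
      ∫ φ in ψ₀..ψ₁, deficit s (A₀ - B₀) (A₁ - A₀) (B₁ - B₀) φ) := by
  obtain ⟨α, hα, az, at', al, ar⟩ := exists_switch_pos hle hπ ha0 ha1
  obtain ⟨β, hβ, bz, bt, bl, br⟩ := exists_switch_neg hle hπ hb0 hb1
  rcases le_total α β with h | h
  · exact of_signs_opposite_of_le hs hπ h0 h1 hα az at' al ar hβ bz bt bl br h
  -- Exchanging the discs interchanges the roles of α and β.
  · have sh : ∀ {x y φ : ℝ}, φ ∈ Icc (x + Real.pi) (y + Real.pi) → φ - Real.pi ∈ Icc x y :=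
      fun h => ⟨by linarith [h.1], by linarith [h.2]⟩
    have pp : ∀ (φ : ℝ) (x : Plane), pr φ x = -pr (φ - Real.pi) x := fun φ x => by
      rw [pr_sub_pi, neg_neg]
    have tp : ∀ (φ : ℝ) (x : Plane), tg (φ + Real.pi) x = -tg φ x := fun φ x => by
      simp [tg_apply]; ring
    have m0 : A₀ - B₀ = -(B₀ - A₀) := (neg_sub _ _).symm
    have m1 : A₁ - B₁ = -(B₁ - A₁) := (neg_sub _ _).symm
    refine of_swap (of_signs_opposite_of_le (α := β + Real.pi) (β := α + Real.pi) hs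
      (by linarith) (by rwa [pr_add_pi, ← map_neg, ← m0]) (by rwa [pr_add_pi, ← map_neg, ← m1])
      ⟨by linarith [hβ.1], by linarith [hβ.2]⟩ (by rw [pr_add_pi, bz, neg_zero])
      (by rw [tp, bt, neg_neg])
      (fun φ hφ => by rw [pp, neg_nonpos]; exact bl _ (sh hφ))
      (fun φ hφ => by rw [pp, neg_nonneg]; exact br _ (sh hφ))
      ⟨by linarith [hα.1], by linarith [hα.2]⟩ (by rw [pr_add_pi, az, neg_zero])
      (by rw [tp, at'])
      (fun φ hφ => by rw [pp, neg_nonneg]; exact al _ (sh hφ))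
      (fun φ hφ => by rw [pp, neg_nonpos]; exact ar _ (sh hφ)) (by linarith))

theorem of_b_signs (hs : 0 < s) (hle : ψ₀ ≤ ψ₁) (hπ : ψ₁ ≤ ψ₀ + Real.pi)
    (h0 : s ≤ pr ψ₀ (A₀ - B₀)) (h1 : s ≤ pr ψ₁ (A₁ - B₁))
    (hb0 : 0 < pr ψ₀ (B₁ - B₀)) (hb1 : pr ψ₁ (B₁ - B₀) < 0) :
    Reach s ⟨A₀, B₀⟩ ⟨A₁, B₁⟩ (‖A₁ - A₀‖ + ‖B₁ - B₀‖ +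
      ∫ φ in ψ₀..ψ₁, deficit s (A₀ - B₀) (A₁ - A₀) (B₁ - B₀) φ) := by
  rcases sign_cases (A₁ - A₀) hle hπ with h | h | h | h
  · exact of_a_nonneg hs hle hπ h0 h1 h
  · exact of_a_nonpos hs hle hπ h0 h1 h
  · exact of_signs_same hs hle hπ h0 h1 h.1 h.2 hb0 hb1
  · exact of_signs_opposite hs hle hπ h0 h1 h.1 h.2 hb0 hb1

/-- Turning by an angle of at most `π`, from a half-plane of directions in which the initial
placement is compatible to one in which the final placement is. -/
theorem of_angles (hs : 0 < s) (hle : ψ₀ ≤ ψ₁) (hπ : ψ₁ ≤ ψ₀ + Real.pi)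
    (h0 : s ≤ pr ψ₀ (A₀ - B₀)) (h1 : s ≤ pr ψ₁ (A₁ - B₁)) :
    Reach s ⟨A₀, B₀⟩ ⟨A₁, B₁⟩ (‖A₁ - A₀‖ + ‖B₁ - B₀‖ +
      ∫ φ in ψ₀..ψ₁, deficit s (A₀ - B₀) (A₁ - A₀) (B₁ - B₀) φ) := by
  have hI := integral_deficit_nonneg (s := s) (p := A₀ - B₀) (a := A₁ - A₀) (b := B₁ - B₀) hle
  by_cases hb : 0 < pr ψ₀ (B₁ - B₀) ∧ pr ψ₁ (B₁ - B₀) < 0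
  · exact of_b_signs hs hle hπ h0 h1 hb.1 hb.2
  by_cases ha : pr ψ₀ (A₁ - A₀) < 0 ∧ 0 < pr ψ₁ (A₁ - A₀)
  · refine of_swap (of_b_signs hs (by linarith) (by linarith) ?_ ?_ ?_ ?_)
    · rw [pr_add_pi, ← map_neg, neg_sub]; exact h0
    · rw [pr_add_pi, ← map_neg, neg_sub]; exact h1
    · rw [pr_add_pi]; linarith
    · rw [pr_add_pi]; linarith
  -- Neither disc passes from hindering to helping, so each moves on a straight line inside the
  -- half-plane of ψ₀ or of ψ₁, at no extra cost.
  rw [not_and_or, not_lt, not_lt] at hb ha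
  rcases ha with ha | ha <;> rcases hb with hb | hb
  · have h2 : s ≤ pr ψ₀ (A₁ - B₀) := by simp only [map_sub] at *; linarith
    exact ((lineA h0 h2).trans (lineB h2 (by simp only [map_sub] at *; linarith))).mono
      (by linarith)
  · have h2 : s ≤ pr ψ₀ (A₁ - B₀) := by simp only [map_sub] at *; linarith
    have h3 : s ≤ pr ψ₁ (A₁ - B₀) := by simp only [map_sub] at *; linarith
    exact ((lineA h0 h2).trans (lineB h3 h1)).mono (by linarith)
  · have h2 : s ≤ pr ψ₀ (A₀ - B₁) := by simp only [map_sub] at *; linarith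
    have h3 : s ≤ pr ψ₁ (A₀ - B₁) := by simp only [map_sub] at *; linarith
    exact ((lineB h0 h2).trans (lineA h3 h1)).mono (by linarith)
  · have h2 : s ≤ pr ψ₁ (A₁ - B₀) := by simp only [map_sub] at *; linarith
    exact ((lineA (by simp only [map_sub] at *; linarith) h2).trans (lineB h2 h1)).mono
      (by linarith)

end Reach

/-! ### Choosing the sense of rotation -/

section deficit

variable {s : ℝ} {p a b : Plane}

theorem deficit_add_two_pi (φ : ℝ) : deficit s p a b (φ + 2 * Real.pi) = deficit s p a b φ := by
  simp only [deficit, pr_add_two_pi]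

/-- The support function of a segment ignores its orientation; thus clockwise motions are reversed
counter-clockwise motions from the final to the initial placement. -/
theorem deficit_reverse : deficit s (p + a - b) (-a) (-b) = deficit s p a b := by
  funext φ
  have h1 := max_zero_sub_max_neg_zero_eq_self (pr φ a)
  have h2 := max_zero_sub_max_neg_zero_eq_self (pr φ b)
  simp only [deficit, map_add, map_sub, map_neg, neg_neg]
  congr 1
  rw [max_comm] at h1 h2
  simp only [max_comm (0 : ℝ)] at *
  linarith

theorem integral_deficit_add_two_pi (α β : ℝ) :
    ∫ φ in (α + 2 * Real.pi)..(β + 2 * Real.pi), deficit s p a b φ =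
      ∫ φ in α..β, deficit s p a b φ := by
  rw [← intervalIntegral.integral_comp_add_right]
  simp only [deficit_add_two_pi]

/-- H_AB(φ) - H_AB(φ + π) is the φ-component of the sum of the initial and final relative positions.
-/
theorem deficit_le_add_pi {φ : ℝ} (h : 0 ≤ pr φ (p + (p + a - b))) :
    deficit s p a b φ ≤ deficit s p a b (φ + Real.pi) := by
  have h1 := max_zero_sub_max_neg_zero_eq_self (pr φ a)
  have h2 := max_zero_sub_max_neg_zero_eq_self (pr φ b)
  simp only [deficit, pr_add_pi, neg_neg]
  refine max_le_max ?_ le_rfl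
  simp only [map_add, map_sub] at h
  linarith

end deficit

/-- Turning counter-clockwise is possible at the expected cost, unless turning clockwise is at least
as good. -/
theorem Reach.of_angles_or {s θ₀ θ₁ : ℝ} {A₀ A₁ B₀ B₁ : Plane} (hs : 0 < s) (hle : θ₀ ≤ θ₁)
    (hle' : θ₁ ≤ θ₀ + 2 * Real.pi)
    (h0 : s ≤ pr θ₀ (A₀ - B₀)) (h1 : s ≤ pr θ₁ (A₁ - B₁)) :
    Reach s ⟨A₀, B₀⟩ ⟨A₁, B₁⟩ (‖A₁ - A₀‖ + ‖B₁ - B₀‖ +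
      ∫ φ in θ₀..θ₁, deficit s (A₀ - B₀) (A₁ - A₀) (B₁ - B₀) φ) ∨
    (θ₀ + Real.pi < θ₁ ∧ ∫ φ in θ₁..(θ₀ + 2 * Real.pi), deficit s (A₀ - B₀) (A₁ - A₀) (B₁ - B₀) φ ≤
      ∫ φ in θ₀..θ₁, deficit s (A₀ - B₀) (A₁ - A₀) (B₁ - B₀) φ) := by
  have hp := Real.pi_pos
  by_cases hπ : θ₁ ≤ θ₀ + Real.pi
  · exact Or.inl (of_angles hs hle hπ h0 h1)
  push Not at hπ
  -- If this sum is negative, the final component at θ₀ is below -s, so the final placement is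
  -- already good at θ₀ + π. The next case is the same at θ₁.
  by_cases k0 : 0 ≤ pr θ₀ (A₀ - B₀) + pr θ₀ (A₁ - B₁)
  swap
  · left
    refine (of_angles (ψ₁ := θ₀ + Real.pi) hs (by linarith) le_rfl h0
      (by rw [pr_add_pi]; linarith)).mono ?_
    have := integral_deficit_mono (s := s) (p := A₀ - B₀) (a := A₁ - A₀) (b := B₁ - B₀)
      (le_refl θ₀) (by linarith : θ₀ ≤ θ₀ + Real.pi) hπ.le
    linarith
  by_cases k1 : 0 ≤ pr θ₁ (A₀ - B₀) + pr θ₁ (A₁ - B₁)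
  swap
  · left
    refine (of_angles (ψ₀ := θ₁ - Real.pi) hs (by linarith) (by linarith)
      (by rw [pr_sub_pi]; linarith) h1).mono ?_
    have := integral_deficit_mono (s := s) (p := A₀ - B₀) (a := A₁ - A₀) (b := B₁ - B₀)
      (by linarith : θ₀ ≤ θ₁ - Real.pi) (by linarith) (le_refl θ₁)
    linarith
  right
  refine ⟨hπ, ?_⟩
  have e : A₀ - B₀ + (A₀ - B₀ + (A₁ - A₀) - (B₁ - B₀)) = (A₀ - B₀) + (A₁ - B₁) := by abel
  have hc := pr_nonneg_between (ψ₀ := θ₁) (ψ₁ := θ₀ + 2 * Real.pi) (x := (A₀ - B₀) + (A₁ - B₁))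
    (by linarith) (by rw [map_add]; exact k1) (by rw [pr_add_two_pi, map_add]; exact k0)
  -- The short range, shifted by π, lies inside the long one modulo 2π, and the shift does not
  -- decrease the deficit.
  calc ∫ φ in θ₁..(θ₀ + 2 * Real.pi), deficit s (A₀ - B₀) (A₁ - A₀) (B₁ - B₀) φ
      ≤ ∫ φ in θ₁..(θ₀ + 2 * Real.pi),
          deficit s (A₀ - B₀) (A₁ - A₀) (B₁ - B₀) (φ + Real.pi) := by
        refine intervalIntegral.integral_mono_on hle' (intervalIntegrable_deficit _ _)
          (Continuous.intervalIntegrable (by fun_prop) _ _) fun φ hφ => ?_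
        exact deficit_le_add_pi (by rw [e]; exact hc φ hφ)
    _ = ∫ φ in (θ₁ + Real.pi)..(θ₀ + 2 * Real.pi + Real.pi),
          deficit s (A₀ - B₀) (A₁ - A₀) (B₁ - B₀) φ :=
        intervalIntegral.integral_comp_add_right _ _
    _ ≤ ∫ φ in (θ₀ + 2 * Real.pi)..(θ₁ + 2 * Real.pi),
          deficit s (A₀ - B₀) (A₁ - A₀) (B₁ - B₀) φ :=
        integral_deficit_mono (by linarith) (by linarith) (by linarith)
    _ = _ := integral_deficit_add_two_pi _ _

/-- The better one of the two directions of rotation can be realized at the expected cost. -/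
theorem Reach.of_angles_min {s θ₀ θ₁ : ℝ} {A₀ A₁ B₀ B₁ : Plane} (hs : 0 < s) (hle : θ₀ ≤ θ₁)
    (hle' : θ₁ ≤ θ₀ + 2 * Real.pi)
    (h0 : s ≤ pr θ₀ (A₀ - B₀)) (h1 : s ≤ pr θ₁ (A₁ - B₁)) :
    Reach s ⟨A₀, B₀⟩ ⟨A₁, B₁⟩ (‖A₁ - A₀‖ + ‖B₁ - B₀‖ +
      min (∫ φ in θ₀..θ₁, deficit s (A₀ - B₀) (A₁ - A₀) (B₁ - B₀) φ)
        (∫ φ in θ₁..(θ₀ + 2 * Real.pi), deficit s (A₀ - B₀) (A₁ - A₀) (B₁ - B₀) φ)) := by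
  have e : deficit s (A₁ - B₁) (A₀ - A₁) (B₀ - B₁) = deficit s (A₀ - B₀) (A₁ - A₀) (B₁ - B₀) := by
    rw [← deficit_reverse]
    congr 1 <;> abel
  have H := of_angles_or hs hle hle' h0 h1
  -- The same for the reversed problem; the two ranges cannot both exceed π.
  have H' := of_angles_or (θ₀ := θ₁) (θ₁ := θ₀ + 2 * Real.pi) hs hle' (by linarith) h1
    (by rw [pr_add_two_pi]; exact h0)
  rw [e, integral_deficit_add_two_pi, norm_sub_rev A₀, norm_sub_rev B₀] at H'
  rcases H with H | ⟨hπ, H⟩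
  · rcases H' with H' | ⟨-, H'⟩
    · rcases min_choice (∫ φ in θ₀..θ₁, deficit s (A₀ - B₀) (A₁ - A₀) (B₁ - B₀) φ)
        (∫ φ in θ₁..(θ₀ + 2 * Real.pi), deficit s (A₀ - B₀) (A₁ - A₀) (B₁ - B₀) φ) with h | h
      · rwa [h]
      · rw [h]; exact H'.symm
    · rwa [min_eq_left H']
  · rcases H' with H' | ⟨hπ', -⟩
    · rw [min_eq_right H]; exact H'.symm
    · linarith

/-! ### Cauchy's formula for polygons -/

/-- The closed polygon with vertices `f 0, …, f n` on the line covers every distance twice. -/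
theorem two_mul_sub_le_sum {f : ℕ → ℝ} {n i j : ℕ} (hi : i ≤ n) (hj : j ≤ n) :
    2 * (f i - f j) ≤ ∑ k ∈ Finset.range n, |f (k + 1) - f k| + |f n - f 0| := by
  have key : ∀ {i j : ℕ}, i ≤ j → j ≤ n →
      2 * |f i - f j| ≤ ∑ k ∈ Finset.range n, |f (k + 1) - f k| + |f n - f 0| := by
    intro i j hij hj
    have h1 := dist_le_Ico_sum_dist f (Nat.zero_le i)
    have h2 := dist_le_Ico_sum_dist f hij
    have h3 := dist_le_Ico_sum_dist f hj
    have h4 := Finset.sum_Ico_consecutive (fun k => dist (f k) (f (k + 1))) (Nat.zero_le i) hij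
    have h5 := Finset.sum_Ico_consecutive (fun k => dist (f k) (f (k + 1)))
      (Nat.zero_le j) hj
    have h6 : ∑ k ∈ Finset.range n, |f (k + 1) - f k| =
        ∑ k ∈ Finset.Ico 0 n, dist (f k) (f (k + 1)) := by
      rw [Finset.range_eq_Ico]
      exact Finset.sum_congr rfl fun k _ => by rw [Real.dist_eq, abs_sub_comm]
    rw [Real.dist_eq] at h1 h2 h3
    rw [h6]
    have t1 : |f i - f j| ≤ |f 0 - f i| + |f n - f 0| + |f j - f n| := by
      have e : f i - f j = -(f 0 - f i) - (f n - f 0) - (f j - f n) := by ring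
      rw [e]
      refine (abs_sub _ _).trans (add_le_add ((abs_sub _ _).trans ?_) le_rfl)
      rw [abs_neg]
    linarith
  refine (mul_le_mul_of_nonneg_left (le_abs_self _) zero_le_two).trans ?_
  rcases le_total i j with h | h
  · exact key h hj
  · rw [abs_sub_comm]; exact key h hi

/-- The support function of the polygon with vertices `x 0, …, x n`. -/
noncomputable def maxPr (n : ℕ) (x : ℕ → Plane) (θ : ℝ) : ℝ :=
  (Finset.range (n + 1)).sup' ⟨0, by simp⟩ fun k => pr θ (x k)

section maxPr

variable {n : ℕ} {x : ℕ → Plane}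

theorem pr_le_maxPr {k : ℕ} (hk : k ≤ n) (θ : ℝ) : pr θ (x k) ≤ maxPr n x θ :=
  Finset.le_sup' (fun k => pr θ (x k)) (Finset.mem_range.2 (Nat.lt_succ_of_le hk))

theorem exists_maxPr_eq (θ : ℝ) : ∃ k ≤ n, maxPr n x θ = pr θ (x k) := by
  obtain ⟨k, hk, e⟩ := Finset.exists_mem_eq_sup' (s := Finset.range (n + 1)) ⟨0, by simp⟩
    fun k => pr θ (x k)
  exact ⟨k, Nat.le_of_lt_succ (Finset.mem_range.1 hk), e⟩

@[fun_prop] theorem continuous_maxPr : Continuous (maxPr n x) := by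
  unfold maxPr
  exact Continuous.finset_sup'_apply _ fun k _ => continuous_pr (x k)

theorem maxPr_add_two_pi (θ : ℝ) : maxPr n x (θ + 2 * Real.pi) = maxPr n x θ := by
  simp only [maxPr, pr_add_two_pi]

end maxPr

/-- Opposite directions give opposite components, so there is a zero; adding π to it corrects the
sign of `tg`. -/
theorem exists_pr_eq_zero (x : Plane) : ∃ γ, pr γ x = 0 ∧ tg γ x = ‖x‖ := by
  have key : ∃ γ, pr γ x = 0 := by
    rcases le_total (pr 0 x) 0 with h | h
    · obtain ⟨γ, -, e⟩ := intermediate_value_Icc (f := fun φ => pr φ x) Real.pi_pos.le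
        (continuous_pr x).continuousOn
        (show (0 : ℝ) ∈ Icc _ _ from ⟨h, by
          have := pr_add_pi 0 x; rw [zero_add] at this; simp only [this]; linarith⟩)
      exact ⟨γ, e⟩
    · obtain ⟨γ, -, e⟩ := intermediate_value_Icc' (f := fun φ => pr φ x) Real.pi_pos.le
        (continuous_pr x).continuousOn
        (show (0 : ℝ) ∈ Icc _ _ from ⟨by
          have := pr_add_pi 0 x; rw [zero_add] at this; simp only [this]; linarith, h⟩)
      exact ⟨γ, e⟩
  obtain ⟨γ, hγ⟩ := key
  rcases le_total 0 (tg γ x) with h | h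
  · exact ⟨γ, hγ, by rw [norm_eq_abs_tg hγ, abs_of_nonneg h]⟩
  · refine ⟨γ + Real.pi, by rw [pr_add_pi, hγ, neg_zero], ?_⟩
    rw [norm_eq_abs_tg hγ, abs_of_nonpos h]
    simp [tg_apply]; ring

theorem integral_period_eq {f : ℝ → ℝ} (hf : ∀ θ, f (θ + 2 * Real.pi) = f θ) (t t' : ℝ) :
    ∫ θ in t..(t + 2 * Real.pi), f θ = ∫ θ in t'..(t' + 2 * Real.pi), f θ :=
  Function.Periodic.intervalIntegral_add_eq hf t t'

/-- From a suitable origin the component is ‖x‖ sin, whose positive part integrates to 2‖x‖. -/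
theorem integral_max_pr (x : Plane) (t : ℝ) :
    ∫ θ in t..(t + 2 * Real.pi), max (pr θ x) 0 = 2 * ‖x‖ := by
  obtain ⟨γ, h0, h1⟩ := exists_pr_eq_zero x
  have hp := Real.pi_pos
  rw [integral_period_eq (fun θ => by rw [pr_add_two_pi]) t (γ - Real.pi),
    integral_max_pos (α := γ) (by linarith) (by linarith) h1]
  · have : tg (γ - Real.pi + 2 * Real.pi) x = -tg γ x := by
      rw [show γ - Real.pi + 2 * Real.pi = γ + Real.pi by ring]
      simp [tg_apply]; ring
    rw [this, h1]; ring
  · intro φ hφ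
    rw [pr_eq_of_zero h0, h1]
    exact mul_nonpos_of_nonneg_of_nonpos (norm_nonneg x)
      (Real.sin_nonpos_of_nonpos_of_neg_pi_le (by linarith [hφ.2]) (by linarith [hφ.1]))
  · intro φ hφ
    rw [pr_eq_of_zero h0, h1]
    exact mul_nonneg (norm_nonneg x)
      (Real.sin_nonneg_of_nonneg_of_le_pi (by linarith [hφ.1]) (by linarith [hφ.2]))

theorem integral_pr_period (x : Plane) (t : ℝ) :
    ∫ θ in t..(t + 2 * Real.pi), pr θ x = 0 := by
  rw [integral_pr, sub_eq_zero]
  simp [tg_apply]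

theorem integral_abs_pr (x : Plane) (t : ℝ) :
    ∫ θ in t..(t + 2 * Real.pi), |pr θ x| = 4 * ‖x‖ := by
  have e : ∀ θ, |pr θ x| = 2 * max (pr θ x) 0 - pr θ x := by
    intro θ
    rcases le_total 0 (pr θ x) with h | h
    · rw [abs_of_nonneg h, max_eq_left h]; ring
    · rw [abs_of_nonpos h, max_eq_right h]; ring
  simp only [e]
  rw [intervalIntegral.integral_sub (Continuous.intervalIntegrable (by fun_prop) _ _)
    (Continuous.intervalIntegrable (by fun_prop) _ _), intervalIntegral.integral_const_mul,
    integral_max_pr, integral_pr_period]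
  ring

/-- Cauchy's formula as an inequality: the integral of the support function of a closed polygon is
at most its length. -/
theorem integral_maxPr_le (n : ℕ) (x : ℕ → Plane) (t : ℝ) :
    ∫ θ in t..(t + 2 * Real.pi), maxPr n x θ ≤
      ∑ k ∈ Finset.range n, ‖x (k + 1) - x k‖ + ‖x n - x 0‖ := by
  have hle : t ≤ t + 2 * Real.pi := by linarith [Real.pi_pos]
  -- The projection of the closed polygon on a line covers its width twice. Integrating, each edge
  -- contributes 4 times its length, and both support terms have the same integral.
  have hpt : ∀ θ, 2 * (maxPr n x θ + maxPr n x (θ + Real.pi)) ≤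
      ∑ k ∈ Finset.range n, |pr θ (x (k + 1) - x k)| + |pr θ (x n - x 0)| := by
    intro θ
    obtain ⟨i, hi, ei⟩ := exists_maxPr_eq (n := n) (x := x) θ
    obtain ⟨j, hj, ej⟩ := exists_maxPr_eq (n := n) (x := x) (θ + Real.pi)
    rw [ei, ej, pr_add_pi, ← sub_eq_add_neg]
    simp only [map_sub]
    exact two_mul_sub_le_sum (f := fun k => pr θ (x k)) hi hj
  have h := intervalIntegral.integral_mono_on (μ := MeasureTheory.volume) hle
    (Continuous.intervalIntegrable (by fun_prop) _ _)
    (Continuous.intervalIntegrable (by fun_prop) _ _) fun θ _ => hpt θ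
  have e1 : ∫ θ in t..(t + 2 * Real.pi), maxPr n x (θ + Real.pi) =
      ∫ θ in t..(t + 2 * Real.pi), maxPr n x θ := by
    rw [intervalIntegral.integral_comp_add_right,
      show t + 2 * Real.pi + Real.pi = t + Real.pi + 2 * Real.pi by ring]
    exact integral_period_eq maxPr_add_two_pi _ _
  have e2 : ∫ θ in t..(t + 2 * Real.pi), ∑ k ∈ Finset.range n, |pr θ (x (k + 1) - x k)| =
      ∑ k ∈ Finset.range n, ∫ θ in t..(t + 2 * Real.pi), |pr θ (x (k + 1) - x k)| :=
    intervalIntegral.integral_finsetSum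
      fun k _ => Continuous.intervalIntegrable (by fun_prop) _ _
  rw [intervalIntegral.integral_const_mul, intervalIntegral.integral_add
    (Continuous.intervalIntegrable (by fun_prop) _ _)
    (Continuous.intervalIntegrable (by fun_prop) _ _), e1, intervalIntegral.integral_add
    (Continuous.intervalIntegrable (by fun_prop) _ _)
    (Continuous.intervalIntegrable (by fun_prop) _ _), e2] at h
  simp only [integral_abs_pr, ← Finset.mul_sum] at h
  linarith

/-! ### The lower bound for the length -/

/-- Sampling a curve at equidistant times. -/
theorem exists_sample {p q p' q' : Plane} (ξ : Path p q) (η : Path p' q') {ε : ℝ} (hε : 0 < ε) :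
    ∃ (n : ℕ) (τ : ℕ → unitInterval), Monotone τ ∧ τ 0 = 0 ∧ τ n = 1 ∧
      ∀ t, ∃ k ≤ n, dist (ξ t) (ξ (τ k)) ≤ ε ∧ dist (η t) (η (τ k)) ≤ ε := by
  have hξ := CompactSpace.uniformContinuous_of_continuous ξ.continuous
  have hη := CompactSpace.uniformContinuous_of_continuous η.continuous
  obtain ⟨δ, hδ, h1⟩ := Metric.uniformContinuous_iff.1 hξ ε hε
  obtain ⟨δ', hδ', h2⟩ := Metric.uniformContinuous_iff.1 hη ε hε
  obtain ⟨n, hn⟩ := exists_nat_one_div_lt (lt_min hδ hδ')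
  have hn0 : (0 : ℝ) < (n : ℝ) + 1 := by positivity
  refine ⟨n + 1, fun k => projIcc 0 1 zero_le_one ((k : ℝ) / (n + 1)), ?_, ?_, ?_, fun t => ?_⟩
  · intro k k' hk
    exact monotone_projIcc _ (by gcongr)
  · simp
  · simp only [Nat.cast_add, Nat.cast_one]
    rw [div_self hn0.ne', projIcc_right]; rfl
  · have ht := t.2
    have hf := Nat.floor_le (mul_nonneg ht.1 hn0.le)
    have hf' := Nat.lt_floor_add_one ((t : ℝ) * (n + 1))
    set k := ⌊(t : ℝ) * (n + 1)⌋₊ with hk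
    have hkn : k ≤ n + 1 := by
      have : (k : ℝ) ≤ ((n + 1 : ℕ) : ℝ) := by
        push_cast
        nlinarith [ht.2]
      exact_mod_cast this
    have hmem : (k : ℝ) / (n + 1) ∈ Icc (0 : ℝ) 1 := by
      refine ⟨by positivity, (div_le_one hn0).2 (by exact_mod_cast hkn)⟩
    have hd : dist t (projIcc 0 1 zero_le_one ((k : ℝ) / (n + 1))) < min δ δ' := by
      refine lt_of_le_of_lt ?_ hn
      rw [Subtype.dist_eq, projIcc_of_mem zero_le_one hmem, Real.dist_eq, abs_of_nonneg]
      · rw [sub_le_iff_le_add, ← add_div, le_div_iff₀ hn0]; linarith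
      · rw [sub_nonneg, div_le_iff₀ hn0]; exact hf
    exact ⟨k, hkn, (h1 (hd.trans_le (min_le_left _ _))).le,
      (h2 (hd.trans_le (min_le_right _ _))).le⟩

theorem Trajectory.sum_le_length {p q : Plane} (ξ : Trajectory p q) {τ : ℕ → unitInterval}
    (hτ : Monotone τ) (n : ℕ) :
    ∑ k ∈ Finset.range n, ‖ξ.curve (τ (k + 1)) - ξ.curve (τ k)‖ ≤ ξ.length := by
  have h := eVariationOn.sum_le (f := ξ.curve) (s := univ) (n := n) hτ fun _ => mem_univ _
  have h' := ENNReal.toReal_mono ξ.rectifiable h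
  rw [ENNReal.toReal_sum fun _ _ => edist_ne_top _ _] at h'
  simpa only [Trajectory.length, ← dist_edist, dist_eq_norm] using h'

/-- The lower bound for the length of a motion that meets all angles in `[x, x']`. -/
theorem Motion.length_ge {s : ℝ} {P₀ P₁ : Placement} (m : Motion P₀ P₁)
    {x x' : ℝ} (hle : x ≤ x') (hle' : x' ≤ x + 2 * Real.pi)
    (hcov : ∀ θ ∈ Icc x x', ∃ t, s ≤ pr θ (m.trajA.curve t - m.trajB.curve t)) :
    ‖P₁.A - P₀.A‖ + ‖P₁.B - P₀.B‖ +
      ∫ φ in x..x', deficit s (P₀.A - P₀.B) (P₁.A - P₀.A) (P₁.B - P₀.B) φ ≤ m.length := by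
  set p := P₀.A - P₀.B with hp
  set a := P₁.A - P₀.A with ha
  set b := P₁.B - P₀.B with hb
  have hpi := Real.pi_pos
  refine le_of_forall_pos_le_add fun ε' hε' => ?_
  -- Sampling costs ε for each disc at angles of total measure at most 2π.
  obtain ⟨ε, hε, hεε⟩ : ∃ ε : ℝ, 0 < ε ∧ 4 * Real.pi * ε = ε' :=
    ⟨ε' / (4 * Real.pi), by positivity, by field_simp⟩
  obtain ⟨n, τ, hτ, τ0, τ1, hs⟩ := exists_sample m.trajA.curve m.trajB.curve hε
  set X : ℕ → Plane := fun k => m.trajA.curve (τ k) with hX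
  -- With the sign reversed, `maxPr n Y θ` plays the role of the support function of the second
  -- curve at π + θ.
  set Y : ℕ → Plane := fun k => -m.trajB.curve (τ k) with hY
  have X0 : X 0 = P₀.A := by simp [hX, τ0]
  have X1 : X n = P₁.A := by simp [hX, τ1]
  have Y0 : Y 0 = -P₀.B := by simp [hY, τ0]
  have Y1 : Y n = -P₁.B := by simp [hY, τ1]
  have lX := integral_maxPr_le n X x
  have lY := integral_maxPr_le n Y x
  have sX := m.trajA.sum_le_length hτ n
  have sY : ∑ k ∈ Finset.range n, ‖Y (k + 1) - Y k‖ ≤ m.trajB.length := by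
    refine le_trans (le_of_eq (Finset.sum_congr rfl fun k _ => ?_)) (m.trajB.sum_le_length hτ n)
    rw [hY, ← norm_neg]; congr 1; simp only; abel
  rw [X0, X1, ← ha] at lX
  rw [Y0, Y1, show -P₁.B - -P₀.B = -b by rw [hb]; abel, norm_neg] at lY
  have base : ∀ θ, pr θ p + max (pr θ a) 0 + max (-pr θ b) 0 ≤ maxPr n X θ + maxPr n Y θ := by
    intro θ
    have h1 : pr θ (X 0) ≤ maxPr n X θ := pr_le_maxPr (Nat.zero_le n) θ
    have h2 : pr θ (X n) ≤ maxPr n X θ := pr_le_maxPr le_rfl θ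
    have h3 : pr θ (Y 0) ≤ maxPr n Y θ := pr_le_maxPr (Nat.zero_le n) θ
    have h4 : pr θ (Y n) ≤ maxPr n Y θ := pr_le_maxPr le_rfl θ
    rw [X0] at h1
    rw [X1] at h2
    rw [Y0] at h3
    rw [Y1] at h4
    simp only [hp, ha, hb, map_sub, map_neg] at *
    rcases max_choice (pr θ P₁.A - pr θ P₀.A) 0 with e | e <;>
    rcases max_choice (-(pr θ P₁.B - pr θ P₀.B)) 0 with e' | e' <;>
    rw [e, e'] <;> linarith
  have more : ∀ θ ∈ Icc x x', pr θ p + max (pr θ a) 0 + max (-pr θ b) 0 + deficit s p a b θ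
      ≤ maxPr n X θ + maxPr n Y θ + 2 * ε := by
    intro θ hθ
    obtain ⟨t, ht⟩ := hcov θ hθ
    obtain ⟨k, hk, dA, dB⟩ := hs t
    have h1 : pr θ (X k) ≤ maxPr n X θ := pr_le_maxPr hk θ
    have h2 : pr θ (Y k) ≤ maxPr n Y θ := pr_le_maxPr hk θ
    have h3 := pr_le_norm θ (m.trajA.curve t - X k)
    have h4 := pr_le_norm (θ + Real.pi) (m.trajB.curve t + Y k)
    rw [← dist_eq_norm] at h3
    rw [pr_add_pi, hY, ← sub_eq_add_neg, ← dist_eq_norm] at h4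
    simp only [hY, map_neg, map_sub] at *
    have := base θ
    rcases max_choice (s - (pr θ p + max (pr θ a) 0 + max (-pr θ b) 0)) 0 with e | e
    · rw [deficit, e]; linarith
    · rw [deficit, e]; linarith
  have I : ∀ {f : ℝ → ℝ} {u v : ℝ}, Continuous f →
      IntervalIntegrable f MeasureTheory.volume u v := fun h => h.intervalIntegrable _ _
  -- The deficit is gained on `[x, x']`; on the rest of the turn the bound by the endpoints is
  -- enough.
  have e1 := intervalIntegral.integral_mono_on hle
    (I (by fun_prop)) (I (by fun_prop)) more
  have e2 := intervalIntegral.integral_mono_on hle'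
    (I (by fun_prop)) (I (by fun_prop)) fun θ _ => base θ
  have f1 : ∫ θ in x..x', (pr θ p + max (pr θ a) 0 + max (-pr θ b) 0 + deficit s p a b θ) =
      (∫ θ in x..x', (pr θ p + max (pr θ a) 0 + max (-pr θ b) 0)) +
        ∫ θ in x..x', deficit s p a b θ :=
    intervalIntegral.integral_add (I (by fun_prop)) (I (by fun_prop))
  have f2 : ∫ θ in x..x', (maxPr n X θ + maxPr n Y θ + 2 * ε) =
      (∫ θ in x..x', (maxPr n X θ + maxPr n Y θ)) + (x' - x) * (2 * ε) := by
    rw [intervalIntegral.integral_add (I (by fun_prop)) (I (by fun_prop)),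
      intervalIntegral.integral_const, smul_eq_mul]
  rw [f1, f2] at e1
  have e3 := intervalIntegral.integral_add_adjacent_intervals
    (I (f := fun θ => maxPr n X θ + maxPr n Y θ) (u := x) (v := x') (by fun_prop))
    (I (v := x + 2 * Real.pi) (by fun_prop))
  have e4 := intervalIntegral.integral_add_adjacent_intervals
    (I (f := fun θ => pr θ p + max (pr θ a) 0 + max (-pr θ b) 0) (u := x) (v := x') (by fun_prop))
    (I (v := x + 2 * Real.pi) (by fun_prop))
  have e5 : ∫ θ in x..(x + 2 * Real.pi), (pr θ p + max (pr θ a) 0 + max (-pr θ b) 0) =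
      2 * ‖a‖ + 2 * ‖b‖ := by
    rw [intervalIntegral.integral_add (I (by fun_prop)) (I (by fun_prop)),
      intervalIntegral.integral_add (I (by fun_prop)) (I (by fun_prop)), integral_pr_period,
      integral_max_pr]
    have := integral_max_pr (-b) x
    simp only [map_neg, norm_neg] at this
    rw [this]; ring
  have e6 : ∫ θ in x..(x + 2 * Real.pi), (maxPr n X θ + maxPr n Y θ) =
      (∫ θ in x..(x + 2 * Real.pi), maxPr n X θ) + ∫ θ in x..(x + 2 * Real.pi), maxPr n Y θ :=
    intervalIntegral.integral_add (I (by fun_prop)) (I (by fun_prop))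
  have e7 : (x' - x) * (2 * ε) ≤ 2 * Real.pi * (2 * ε) := by
    apply mul_le_mul_of_nonneg_right <;> linarith
  simp only [Motion.length]
  linarith

/-! ### The continuous angle of a compatible motion -/

theorem Placement.HasAngle.pr_rel {P : Placement} {θ : ℝ} (h : P.HasAngle θ) :
    pr θ (P.A - P.B) = dist P.A P.B := by
  have h' : P.A - P.B = dist P.A P.B • uvec θ := h
  rw [h', map_smul, pr_uvec]; simp

/-- A nowhere vanishing curve in the plane has a continuous angle. -/
theorem exists_continuous_angle {r : unitInterval → Plane} (hr : Continuous r) (h0 : ∀ t, r t ≠ 0)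
    {θ₀ : ℝ} (hθ₀ : r 0 = ‖r 0‖ • uvec θ₀) :
    ∃ Γ : unitInterval → ℝ, Continuous Γ ∧ Γ 0 = θ₀ ∧ ∀ t, r t = ‖r t‖ • uvec (Γ t) := by
  have hpos : ∀ t, 0 < ‖r t‖ := fun t => norm_pos_iff.2 (h0 t)
  -- The normalized curve lies on the unit circle and is lifted through the covering map
  -- `Circle.exp`.
  set z : unitInterval → ℂ := fun t => ⟨r t 0 / ‖r t‖, r t 1 / ‖r t‖⟩ with hz
  have hc : ∀ i, Continuous fun t => r t i / ‖r t‖ := fun i =>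
    ((EuclideanSpace.proj (𝕜 := ℝ) i).continuous.comp hr).div₀ hr.norm fun t => (hpos t).ne'
  have hzc : Continuous z := by
    have : z = fun t => Complex.equivRealProdCLM.symm (r t 0 / ‖r t‖, r t 1 / ‖r t‖) := rfl
    rw [this]
    exact Complex.equivRealProdCLM.symm.continuous.comp ((hc 0).prodMk (hc 1))
  have hzn : ∀ t, z t ∈ Submonoid.unitSphere ℂ := by
    intro t
    have : ‖z t‖ ^ 2 = 1 := by
      rw [Complex.sq_norm, Complex.normSq_apply]
      have := norm_sq_plane (r t)
      simp only [hz]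
      have hne := (hpos t).ne'
      field_simp
      linarith
    exact mem_sphere_zero_iff_norm.2 (by nlinarith [norm_nonneg (z t)])
  have e0 : (⟨z 0, hzn 0⟩ : Circle) = Circle.exp θ₀ := by
    apply Subtype.ext
    rw [Circle.coe_exp, Complex.exp_mul_I]
    have hne := (hpos 0).ne'
    have c0 : r 0 0 = ‖r 0‖ * Real.cos θ₀ := by
      conv_lhs => rw [hθ₀]
      simp
    have c1 : r 0 1 = ‖r 0‖ * Real.sin θ₀ := by
      conv_lhs => rw [hθ₀]
      simp
    apply Complex.ext
    · simp only [hz, c0]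
      simp [← Complex.ofReal_cos, ← Complex.ofReal_sin, hne]
    · simp only [hz, c1]
      simp [← Complex.ofReal_cos, ← Complex.ofReal_sin, hne]
  obtain ⟨Γ, hΓ, hΓ0⟩ := Circle.isCoveringMap_exp.exists_path_lifts
    ⟨fun t => ⟨z t, hzn t⟩, hzc.subtype_mk _⟩ θ₀ e0
  refine ⟨Γ, Γ.continuous, hΓ0, fun t => ?_⟩
  have e : Complex.exp ((Γ t : ℂ) * Complex.I) = z t :=
    congrArg (fun c : Circle => (c : ℂ)) (congrFun hΓ t)
  rw [Complex.exp_mul_I] at e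
  have hne := (hpos t).ne'
  have c0 := congrArg Complex.re e
  have c1 := congrArg Complex.im e
  simp only [hz] at c0 c1
  simp [← Complex.ofReal_cos, ← Complex.ofReal_sin] at c0 c1
  apply plane_ext
  · simp only [PiLp.smul_apply, smul_eq_mul, uvec_zero, c0]; field_simp
  · simp only [PiLp.smul_apply, smul_eq_mul, uvec_one, c1]; field_simp

/-- The angle of a compatible motion sweeps one of the two ranges of angles between its ends. -/
theorem Motion.IsCompatible.covers {s : ℝ} (hs : 0 < s) {P₀ P₁ : Placement} {m : Motion P₀ P₁}
    (hm : m.IsCompatible s) {θ₀ θ₁ : ℝ} (hθ₀ : P₀.HasAngle θ₀) (hθ₁ : P₁.HasAngle θ₁) :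
    (∀ θ ∈ Icc θ₀ θ₁, ∃ t, s ≤ pr θ (m.trajA.curve t - m.trajB.curve t)) ∨
    ∀ θ ∈ Icc θ₁ (θ₀ + 2 * Real.pi), ∃ t, s ≤ pr θ (m.trajA.curve t - m.trajB.curve t) := by
  set r : unitInterval → Plane := fun t => m.trajA.curve t - m.trajB.curve t with hr
  have hrs : ∀ t, s ≤ ‖r t‖ := fun t => by
    have := hm t
    rwa [Placement.IsCompatible, Motion.placement, dist_eq_norm] at this
  obtain ⟨Γ, hΓ, hΓ0, h⟩ := exists_continuous_angle (r := r)
    (m.trajA.curve.continuous.sub m.trajB.curve.continuous)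
    (fun t => norm_pos_iff.1 (hs.trans_le (hrs t))) (θ₀ := θ₀) (by
      have : r 0 = P₀.A - P₀.B := by simp [hr]
      rw [this, ← dist_eq_norm]; exact hθ₀)
  have h1 : uvec (Γ 1) = uvec θ₁ := by
    have e1 := h 1
    have er : r 1 = P₁.A - P₁.B := by simp [hr]
    have e2 : r 1 = ‖r 1‖ • uvec θ₁ := by
      rw [er, ← dist_eq_norm]; exact hθ₁
    have hne : ‖r 1‖ ≠ 0 := (hs.trans_le (hrs 1)).ne'
    have e3 : ‖r 1‖ • uvec (Γ 1) = ‖r 1‖ • uvec θ₁ := by rw [← e1, ← e2]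
    exact smul_right_injective _ hne e3
  have hsc : Real.cos (Γ 1) = Real.cos θ₁ ∧ Real.sin (Γ 1) = Real.sin θ₁ :=
    ⟨congrFun (congrArg (fun x : Plane => (x : Fin 2 → ℝ)) h1) 0,
      congrFun (congrArg (fun x : Plane => (x : Fin 2 → ℝ)) h1) 1⟩
  have hk : ∃ k : ℤ, Γ 1 = θ₁ + k * (2 * Real.pi) := by
    apply Circle.exp_eq_exp.1
    apply Subtype.ext
    rw [Circle.coe_exp, Circle.coe_exp, Complex.exp_mul_I, Complex.exp_mul_I,
      ← Complex.ofReal_cos, ← Complex.ofReal_sin, ← Complex.ofReal_cos, ← Complex.ofReal_sin,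
      hsc.1, hsc.2]
  obtain ⟨k, hk⟩ := hk
  have hit : ∀ t, s ≤ pr (Γ t) (r t) := fun t => by
    have : pr (Γ t) (r t) = ‖r t‖ := by
      conv_lhs => rw [h t]
      rw [map_smul, pr_uvec]; simp
    rw [this]; exact hrs t
  have hπ := Real.pi_pos
  -- The lifted angle goes from θ₀ to θ₁ + 2πk: for k ≥ 0 it passes through `[θ₀, θ₁]`, for k ≤ -1
  -- through `[θ₁ - 2π, θ₀]`, a translate of the other range.
  rcases le_or_gt 0 k with hk0 | hk0
  · left
    intro θ hθ
    have hk0' : (0 : ℝ) ≤ k := by exact_mod_cast hk0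
    obtain ⟨t, ht⟩ := mem_range_of_exists_le_of_exists_ge hΓ (c := θ)
      ⟨0, by rw [hΓ0]; exact hθ.1⟩
      ⟨1, by rw [hk]; nlinarith [hθ.2]⟩
    exact ⟨t, by rw [← ht]; exact hit t⟩
  · right
    intro θ hθ
    have hk0' : (k : ℝ) ≤ -1 := by exact_mod_cast (by omega : k ≤ -1)
    obtain ⟨t, ht⟩ := mem_range_of_exists_le_of_exists_ge hΓ (c := θ - 2 * Real.pi)
      ⟨1, by rw [hk]; nlinarith [hθ.1]⟩ ⟨0, by rw [hΓ0]; linarith [hθ.2]⟩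
    refine ⟨t, ?_⟩
    rw [← sub_add_cancel θ (2 * Real.pi), pr_add_two_pi, ← ht]; exact hit t

/-! ### The integrals in the statement and the conclusion -/

theorem supportFunction_segment (x y : Plane) (θ : ℝ) :
    supportFunction (segment ℝ x y) θ = max (pr θ x) (pr θ y) := by
  have h : (fun p : Plane => p 0 * Real.cos θ + p 1 * Real.sin θ) '' segment ℝ x y =
      segment ℝ (pr θ x) (pr θ y) := image_segment ℝ (pr θ).toAffineMap x y
  rw [supportFunction, h, segment_eq_uIcc, uIcc, csSup_Icc inf_le_sup]

/-- Each maximum is measured from the initial endpoint of its segment; this matches the expression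
inside `deficit`. -/
theorem segmentSupport_eq (P₀ P₁ : Placement) (θ : ℝ) :
    segmentSupport P₀ P₁ θ =
      pr θ (P₀.A - P₀.B) + max (pr θ (P₁.A - P₀.A)) 0 + max (-pr θ (P₁.B - P₀.B)) 0 := by
  rw [segmentSupport, supportFunction_segment, supportFunction_segment, add_comm Real.pi,
    pr_add_pi, pr_add_pi]
  simp only [map_sub]
  have h1 : max (pr θ P₁.A - pr θ P₀.A) 0 = max (pr θ P₁.A) (pr θ P₀.A) - pr θ P₀.A := by
    rw [← max_sub_sub_right, sub_self]
  have h2 : max (-(pr θ P₁.B - pr θ P₀.B)) 0 = max (-pr θ P₁.B) (-pr θ P₀.B) + pr θ P₀.B := by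
    rw [← max_add_add_right]; congr 1 <;> ring
  rw [h1, h2, max_comm (pr θ P₁.A), max_comm (-pr θ P₁.B)]
  ring

theorem supportBound_of_mem {s : ℝ} {P₀ P₁ : Placement} {I : Set ℝ} {θ : ℝ} (h : θ ∈ I) :
    supportBound s P₀ P₁ I θ = segmentSupport P₀ P₁ θ +
      deficit s (P₀.A - P₀.B) (P₁.A - P₀.A) (P₁.B - P₀.B) θ := by
  rw [supportBound, if_pos h, deficit, ← segmentSupport_eq, ← max_add_add_left, max_comm]
  simp

theorem supportBound_of_notMem {s : ℝ} {P₀ P₁ : Placement} {I : Set ℝ} {θ : ℝ} (h : θ ∉ I) :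
    supportBound s P₀ P₁ I θ = segmentSupport P₀ P₁ θ := by
  rw [supportBound, if_neg h]

@[fun_prop] theorem continuous_segmentSupport (P₀ P₁ : Placement) :
    Continuous (segmentSupport P₀ P₁) := by
  simp only [funext (segmentSupport_eq P₀ P₁)]
  fun_prop

/-- Cauchy's formula for segments, seen as degenerate polygons of perimeter twice their length. -/
theorem integral_segmentSupport (P₀ P₁ : Placement) (t : ℝ) :
    ∫ θ in t..(t + 2 * Real.pi), segmentSupport P₀ P₁ θ =
      2 * ‖P₁.A - P₀.A‖ + 2 * ‖P₁.B - P₀.B‖ := by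
  simp only [segmentSupport_eq]
  have I : ∀ {f : ℝ → ℝ} {u v : ℝ}, Continuous f →
      IntervalIntegrable f MeasureTheory.volume u v := fun h => h.intervalIntegrable _ _
  rw [intervalIntegral.integral_add (I (by fun_prop)) (I (by fun_prop)),
    intervalIntegral.integral_add (I (by fun_prop)) (I (by fun_prop)), integral_pr_period,
    integral_max_pr]
  have := integral_max_pr (-(P₁.B - P₀.B)) t
  simp only [map_neg, norm_neg] at this
  rw [this]; ring

/-- The integral of the support bound over a full turn, for a periodic set of angles which is an
interval within one turn. -/
theorem integral_supportBound {s x x' : ℝ} {P₀ P₁ : Placement} {I : Set ℝ}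
    (hI : ∀ θ, θ + 2 * Real.pi ∈ I ↔ θ ∈ I) (hle : x ≤ x') (hle' : x' ≤ x + 2 * Real.pi)
    (hin : ∀ θ ∈ Ioo x x', θ ∈ I) (hout : ∀ θ ∈ Ioo x' (x + 2 * Real.pi), θ ∉ I) :
    ∫ θ in (0 : ℝ)..(2 * Real.pi), supportBound s P₀ P₁ I θ =
      2 * ‖P₁.A - P₀.A‖ + 2 * ‖P₁.B - P₀.B‖ +
        ∫ θ in x..x', deficit s (P₀.A - P₀.B) (P₁.A - P₀.A) (P₁.B - P₀.B) θ := by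
  have hper : ∀ θ, supportBound s P₀ P₁ I (θ + 2 * Real.pi) = supportBound s P₀ P₁ I θ := by
    intro θ
    have hd : segmentSupport P₀ P₁ (θ + 2 * Real.pi) = segmentSupport P₀ P₁ θ := by
      simp only [segmentSupport_eq, pr_add_two_pi]
    by_cases h : θ ∈ I
    · rw [supportBound_of_mem h, supportBound_of_mem ((hI θ).2 h), hd, deficit_add_two_pi]
    · rw [supportBound_of_notMem h, supportBound_of_notMem (mt (hI θ).1 h), hd]
  have h1 := integral_period_eq hper 0 x
  rw [zero_add] at h1
  have J : ∀ {f : ℝ → ℝ} {u v : ℝ}, Continuous f →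
      IntervalIntegrable f MeasureTheory.volume u v := fun h => h.intervalIntegrable _ _
  -- Agreement on open intervals suffices for the integrals, so the same lemma serves the closed
  -- range and its open complement.
  have E1 : EqOn (fun θ => segmentSupport P₀ P₁ θ +
      deficit s (P₀.A - P₀.B) (P₁.A - P₀.A) (P₁.B - P₀.B) θ) (supportBound s P₀ P₁ I)
      (uIoo x x') := by
    intro θ hθ
    rw [uIoo_of_le hle] at hθ
    exact (supportBound_of_mem (hin θ hθ)).symm
  have E2 : EqOn (segmentSupport P₀ P₁) (supportBound s P₀ P₁ I)
      (uIoo x' (x + 2 * Real.pi)) := by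
    intro θ hθ
    rw [uIoo_of_le hle'] at hθ
    exact (supportBound_of_notMem (hout θ hθ)).symm
  rw [h1, ← intervalIntegral.integral_add_adjacent_intervals
    ((J (by fun_prop)).congr_uIoo E1) ((J (by fun_prop)).congr_uIoo E2),
    ← intervalIntegral.integral_congr_uIoo E1, ← intervalIntegral.integral_congr_uIoo E2,
    intervalIntegral.integral_add (J (by fun_prop)) (J (by fun_prop)),
    ← integral_segmentSupport P₀ P₁ x, ← intervalIntegral.integral_add_adjacent_intervals
      (J (f := segmentSupport P₀ P₁) (u := x) (v := x') (by fun_prop))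
      (J (v := x + 2 * Real.pi) (by fun_prop))]
  ring

theorem angleRange_add_two_pi (θ₀ θ₁ θ : ℝ) :
    θ + 2 * Real.pi ∈ angleRange θ₀ θ₁ ↔ θ ∈ angleRange θ₀ θ₁ := by
  constructor
  · rintro ⟨k, hk⟩
    refine ⟨k + 1, ?_⟩
    push_cast
    rwa [mul_add, mul_one, add_comm _ (2 * Real.pi), ← add_assoc]
  · rintro ⟨k, hk⟩
    refine ⟨k - 1, ?_⟩
    push_cast
    rwa [mul_sub, mul_one, add_assoc, add_sub_cancel]

theorem mem_angleRange {θ₀ θ₁ θ : ℝ} (h : θ ∈ Icc θ₀ θ₁) : θ ∈ angleRange θ₀ θ₁ :=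
  ⟨0, by simpa using h⟩

theorem notMem_angleRange {θ₀ θ₁ θ : ℝ} (h : θ ∈ Ioo θ₁ (θ₀ + 2 * Real.pi)) :
    θ ∉ angleRange θ₀ θ₁ := by
  rintro ⟨k, hk⟩
  have hπ := Real.pi_pos
  rcases le_or_gt 0 k with hk0 | hk0
  · have hk0' : (0 : ℝ) ≤ k := by exact_mod_cast hk0
    nlinarith [hk.2, h.1]
  · have hk0' : (k : ℝ) ≤ -1 := by exact_mod_cast (by omega : k ≤ -1)
    nlinarith [hk.1, h.2]

theorem corollary4p2 (s : ℝ) (hs : 0 < s) (P₀ P₁ : Placement)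
    (hP₀ : P₀.IsCompatible s) (hP₁ : P₁.IsCompatible s)
    (θ₀ θ₁ : ℝ) (hθ₀ : P₀.HasAngle θ₀) (hθ₁ : P₁.HasAngle θ₁)
    (hle : θ₀ ≤ θ₁) (hlt : θ₁ < θ₀ + 2 * Real.pi) :
    (∃ m : Motion P₀ P₁, m.IsOptimal s) ∧
    ∀ m : Motion P₀ P₁, m.IsOptimal s →
      m.length =
        min (∫ θ in (0 : ℝ)..(2 * Real.pi), supportBound s P₀ P₁ (angleRange θ₀ θ₁) θ)
            (∫ θ in (0 : ℝ)..(2 * Real.pi), supportBound s P₀ P₁ (angleRange θ₀ θ₁)ᶜ θ)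
          - dist P₀.A P₁.A - dist P₀.B P₁.B := by
  have hπ := Real.pi_pos
  have hper := angleRange_add_two_pi θ₀ θ₁
  have e1 := integral_supportBound (s := s) (P₀ := P₀) (P₁ := P₁) hper hle hlt.le
    (fun θ hθ => mem_angleRange (Ioo_subset_Icc_self hθ)) fun θ hθ => notMem_angleRange hθ
  have e2 := integral_supportBound (s := s) (P₀ := P₀) (P₁ := P₁) (I := (angleRange θ₀ θ₁)ᶜ)
    (x := θ₁) (x' := θ₀ + 2 * Real.pi) (fun θ => not_congr (hper θ)) hlt.le (by linarith)
    (fun θ hθ => notMem_angleRange hθ) fun θ hθ hn => hn (by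
      rw [← sub_add_cancel θ (2 * Real.pi), hper]
      exact mem_angleRange ⟨by linarith [hθ.1], by linarith [hθ.2]⟩)
  obtain ⟨m₀, hm₀, hl₀⟩ := Reach.of_angles_min (A₀ := P₀.A) (A₁ := P₁.A) (B₀ := P₀.B)
    (B₁ := P₁.B) hs hle hlt.le (by rw [hθ₀.pr_rel]; exact hP₀) (by rw [hθ₁.pr_rel]; exact hP₁)
  have lower : ∀ m : Motion P₀ P₁, m.IsCompatible s → ‖P₁.A - P₀.A‖ + ‖P₁.B - P₀.B‖ +
      min (∫ φ in θ₀..θ₁, deficit s (P₀.A - P₀.B) (P₁.A - P₀.A) (P₁.B - P₀.B) φ)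
        (∫ φ in θ₁..(θ₀ + 2 * Real.pi),
          deficit s (P₀.A - P₀.B) (P₁.A - P₀.A) (P₁.B - P₀.B) φ) ≤ m.length := by
    intro m hm
    rcases hm.covers hs hθ₀ hθ₁ with h | h
    · refine le_trans ?_ (m.length_ge hle hlt.le h)
      gcongr; exact min_le_left _ _
    · refine le_trans ?_ (m.length_ge hlt.le (by linarith) h)
      gcongr; exact min_le_right _ _
  have opt : m₀.IsOptimal s := ⟨hm₀, fun m' hm' => hl₀.trans (lower m' hm')⟩
  refine ⟨⟨m₀, opt⟩, fun m hm => ?_⟩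
  have h1 := (hm.2 m₀ hm₀).trans hl₀
  have h2 := lower m hm.1
  rw [e1, e2, min_add_add_left, dist_comm P₀.A, dist_comm P₀.B, dist_eq_norm, dist_eq_norm]
  linarith
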